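/- All graphs are finite, undirected and simple (no loops, no parallel edges). Let $H$ be a graph. A partially $H$-labelled graph $J=(G,\tau)$ consists of a graph $G$ and a partial function $\tau$ from $V(G)$ to $V(H)$ (the pinning function, with domain of arbitrary size); a homomorphism from $J$ to $H$ is a graph homomorphism $\sigma\colon G\to H$ with $\sigma(v)=\tau(v)$ for every $v\in\operatorname{dom}(\tau)$. For a prime $p$, let $\#_p\mathrm{HomsTo}H$ be the problem of computing, for an input graph $G$, the number of homomorphisms from $G$ to $H$ modulo $p$, and let $\#_p\mathrm{PartLabHomsTo}H$ be the problem of computing, for an input partially $H$-labelled graph $J$, the number of homomorphisms from $J$ to $H$ modulo $p$; here $p$ and $H$ are fixed parameters and not part of the input. A counting problem $P$ reduces to a counting problem $Q$ via polynomial-time Turing reduction if there is a deterministic oracle Turing machine, running in time polynomial in the length of its input, that on every instance $x$ of $P$ outputs $P(x)$ by making queries to an oracle for $Q$. **Theorem.** Let $p$ be a prime and let $H$ be a graph that has no automorphism of order $p$. Then $\#_p\mathrm{PartLabHomsTo}H$ reduces to $\#_p\mathrm{HomsTo}H$ via polynomial-time Turing reduction. -/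

import Mathlib

/-! ### Oracle Turing machines

A deterministic oracle machine with finitely many tapes. The ordinary instructions are those of
Mathlib's multi-tape model `Turing.TM2` (each tape is a stack whose top is the head of a list), the
model in which Mathlib defines polynomial-time computability. -/

/-- The four tapes through which a machine communicates. They hold bit strings. -/
inductive Port
  | input
  | output
  | query
  | answer
  deriving DecidableEq

/-- The alphabet of each tape: bits on the four communication tapes, `Γ k` on work tape `k`. -/
abbrev TapeAlphabet {K : Type} (Γ : K → Type) : Port ⊕ K → Type
  | .inl _ => Bool
  | .inr k => Γ k

/-- A deterministic multi-tape oracle Turing machine. -/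
structure OracleTM where
  /-- the work tapes -/
  K : Type
  [decEqK : DecidableEq K]
  [fintypeK : Fintype K]
  /-- the alphabets of the work tapes -/
  Γ : K → Type
  [fintypeΓ : ∀ k, Fintype (Γ k)]
  /-- the program labels -/
  Λ : Type
  [fintypeΛ : Fintype Λ]
  /-- the internal memory states -/
  σ : Type
  [fintypeσ : Fintype σ]
  /-- the label at which the computation starts -/
  main : Λ
  /-- the initial memory state -/
  start : σ
  /-- The program: at each label the machine either executes an ordinary statement, or (`inr l`)
  calls the oracle and continues at label `l`. -/
  prog : Λ → Turing.TM2.Stmt (TapeAlphabet Γ) Λ σ ⊕ Λ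

namespace OracleTM

instance (M : OracleTM) : DecidableEq M.K := M.decEqK

/-- The configurations of a machine. The label `none` means that the machine has halted. -/
abbrev Cfg (M : OracleTM) : Type := Turing.TM2.Cfg (TapeAlphabet M.Γ) M.Λ M.σ

/-- One step of the machine `M` with oracle `O`. An oracle call is a single step: it replaces the
content of the answer tape by the oracle's answer to the string on the query tape, and erases the
query tape. A halted machine stays as it is. -/
def step (M : OracleTM) (O : List Bool → List Bool) : M.Cfg → M.Cfg
  | ⟨none, v, S⟩ => ⟨none, v, S⟩
  | ⟨some l, v, S⟩ =>
    match M.prog l with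
    | .inl q => Turing.TM2.stepAux q v S
    | .inr l' =>
      ⟨some l', v,
        Function.update (Function.update S (.inl .query) []) (.inl .answer)
          (O (S (.inl .query)))⟩

/-- The initial configuration: `x` is on the input tape, all other tapes are empty. -/
def initial (M : OracleTM) (x : List Bool) : M.Cfg :=
  ⟨some M.main, M.start, Function.update (fun _ => []) (.inl .input) x⟩

/-- With oracle `O` and input `x`, the machine halts after at most `t` steps with `y` on its output
tape. -/
def OutputsWithin (M : OracleTM) (O : List Bool → List Bool) (x y : List Bool) (t : ℕ) : Prop :=
  ((M.step O)^[t] (M.initial x)).l = none ∧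
    ((M.step O)^[t] (M.initial x)).stk (.inl .output) = y

end OracleTM

/-! ### Counting problems and polynomial-time Turing reductions -/

universe u v

/-- A counting problem: inputs, written as bit strings, to each of which a number is assigned. -/
structure CountingProblem where
  /-- the inputs (instances) of the problem -/
  Input : Type u
  /-- the bit string that represents an input -/
  encode : Input → List Bool
  encode_injective : Function.Injective encode
  /-- the number to be computed -/
  value : Input → ℕ

namespace CountingProblem

/-- The number to be computed, in binary (least significant bit first). -/
def output (P : CountingProblem.{u}) (x : P.Input) : List Bool := Nat.bits (P.value x)

/-- `O` is an oracle for `P`: it answers every input of `P` correctly. Nothing is known about its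
answers to strings that represent no input. -/
def IsOracle (P : CountingProblem.{u}) (O : List Bool → List Bool) : Prop :=
  ∀ x : P.Input, O (P.encode x) = P.output x

/-- `P` reduces to `Q` via polynomial-time Turing reduction: one oracle machine solves `P`, given
any oracle for `Q`, in a number of steps polynomial in the length of the input string. -/
def PolyTimeTuringReducible (P : CountingProblem.{u}) (Q : CountingProblem.{v}) : Prop :=
  ∃ (M : OracleTM) (time : Polynomial ℕ),
    ∀ O : List Bool → List Bool, Q.IsOracle O → ∀ x : P.Input,
      M.OutputsWithin O (P.encode x) (P.output x) (time.eval (P.encode x).length)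

end CountingProblem

/-! ### Encodings of graphs and of partially labelled graphs -/

/-- The self-delimiting unary code of a number. -/
def unaryCode (k : ℕ) : List Bool := List.replicate k true ++ [false]

open scoped Classical in
/-- The adjacency matrix of `G`, row by row. -/
noncomputable def adjBits {n : ℕ} (G : SimpleGraph (Fin n)) : List Bool :=
  (List.finRange n).flatMap fun i => (List.finRange n).map fun j => decide (G.Adj i j)

/-- An input graph, with vertex set `{0, …, n - 1}`. -/
structure FinGraph where
  /-- the number of vertices -/
  n : ℕ
  /-- the graph -/
  graph : SimpleGraph (Fin n)

/-- The number of vertices in unary, followed by the adjacency matrix. -/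
noncomputable def FinGraph.encode (G : FinGraph) : List Bool :=
  unaryCode G.n ++ adjBits G.graph

/-- A partially labelled graph with labels in `V`: a graph `graph`, and a pinning function `pin`,
which is a partial function from its vertices to `V` (`pin v = none` if `v` is not pinned). -/
structure PartLabGraph (V : Type u) where
  /-- the number of vertices -/
  n : ℕ
  /-- the underlying graph -/
  graph : SimpleGraph (Fin n)
  /-- the pinning function -/
  pin : Fin n → Option V

/-- The number that represents a label (`0` for an unpinned vertex), where `e` numbers the possible
labels. -/
def labelIndex {V : Type u} {h : ℕ} (e : V ≃ Fin h) : Option V → ℕ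
  | none => 0
  | some w => (e w : ℕ) + 1

/-- The number of vertices in unary, followed by the label of each vertex, followed by the adjacency
matrix. -/
noncomputable def PartLabGraph.encode {V : Type u} {h : ℕ} (e : V ≃ Fin h) (J : PartLabGraph V) :
    List Bool :=
  unaryCode J.n ++ (((List.finRange J.n).flatMap fun i => unaryCode (labelIndex e (J.pin i))) ++
    adjBits J.graph)

theorem unaryCode_append_inj {a b : ℕ} {s t : List Bool}
    (hab : unaryCode a ++ s = unaryCode b ++ t) : a = b ∧ s = t := by
  induction a generalizing b with
  | zero =>
    cases b with
    | zero => simpa [unaryCode] using hab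
    | succ b => simp [unaryCode, List.replicate_succ] at hab
  | succ a ih =>
    cases b with
    | zero => simp [unaryCode, List.replicate_succ] at hab
    | succ b =>
      have h1 : unaryCode a ++ s = unaryCode b ++ t := by
        simpa [unaryCode, List.replicate_succ] using hab
      obtain ⟨h2, h3⟩ := ih h1
      exact ⟨by rw [h2], h3⟩

theorem flatMap_unaryCode_append_inj {α : Type} (l : List α) {f g : α → ℕ} {s t : List Bool}
    (hfg : (l.flatMap fun a => unaryCode (f a)) ++ s = (l.flatMap fun a => unaryCode (g a)) ++ t) :
    (∀ a ∈ l, f a = g a) ∧ s = t := by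
  induction l with
  | nil => simpa using hfg
  | cons a l ih =>
    simp only [List.flatMap_cons, List.append_assoc] at hfg
    obtain ⟨h1, h2⟩ := unaryCode_append_inj hfg
    obtain ⟨h3, h4⟩ := ih h2
    exact ⟨by simpa using ⟨h1, h3⟩, h4⟩

theorem flatMap_inj_of_length {α β : Type} (l : List α) {f g : α → List β}
    (hlen : ∀ a, (f a).length = (g a).length) (hfg : l.flatMap f = l.flatMap g) :
    ∀ a ∈ l, f a = g a := by
  induction l with
  | nil => simp
  | cons a l ih =>
    simp only [List.flatMap_cons] at hfg
    obtain ⟨h1, h2⟩ := List.append_inj hfg (hlen a)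
    simpa using ⟨h1, ih h2⟩

theorem adjBits_injective {n : ℕ} : Function.Injective (adjBits (n := n)) := by
  intro G G' hG
  have h1 := flatMap_inj_of_length (List.finRange n) (by simp) hG
  ext i j
  have h2 := h1 i (List.mem_finRange i)
  have h3 := List.map_inj_left.mp h2 j (List.mem_finRange j)
  simpa using h3

theorem FinGraph.encode_injective : Function.Injective FinGraph.encode := by
  rintro ⟨n, G⟩ ⟨n', G'⟩ hG
  obtain ⟨h1, h2⟩ := unaryCode_append_inj hG
  dsimp only at h1
  subst h1
  have h3 : G = G' := adjBits_injective h2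
  rw [h3]

theorem labelIndex_injective {V : Type u} {h : ℕ} (e : V ≃ Fin h) :
    Function.Injective (labelIndex e) := by
  intro a b hab
  cases a <;> cases b <;> simp [labelIndex] at hab ⊢
  exact e.injective (Fin.ext hab)

theorem PartLabGraph.encode_injective {V : Type u} {h : ℕ} (e : V ≃ Fin h) :
    Function.Injective (PartLabGraph.encode e) := by
  rintro ⟨n, G, τ⟩ ⟨n', G', τ'⟩ hJ
  obtain ⟨h1, h2⟩ := unaryCode_append_inj hJ
  dsimp only at h1
  subst h1
  obtain ⟨h3, h4⟩ := flatMap_unaryCode_append_inj _ h2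
  have h5 : τ = τ' := funext fun i => labelIndex_injective e (h3 i (List.mem_finRange i))
  have h6 : G = G' := adjBits_injective h4
  rw [h5, h6]

/-! ### The two problems -/

/-- The homomorphisms from a partially labelled graph to `H`. -/
def PartLabGraph.Homs {V : Type u} (J : PartLabGraph V) (H : SimpleGraph V) : Set (J.graph →g H) :=
  {f | ∀ v w, J.pin v = some w → f v = w}

/-- For fixed `p` and `H`: given a graph `G`, compute the number of homomorphisms from `G` to `H`
modulo `p`. -/
noncomputable def homsTo (p : ℕ) {V : Type u} (H : SimpleGraph V) : CountingProblem.{0} where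
  Input := FinGraph
  encode := FinGraph.encode
  encode_injective := FinGraph.encode_injective
  value G := Nat.card (G.graph →g H) % p

/-- For fixed `p` and `H` (with a numbering `e` of the vertices of `H`, used to write labels as
strings): given a partially `H`-labelled graph `J`, compute the number of homomorphisms from `J` to
`H` modulo `p`. -/
noncomputable def partLabHomsTo (p : ℕ) {V : Type u} (H : SimpleGraph V) {h : ℕ} (e : V ≃ Fin h) :
    CountingProblem.{u} where
  Input := PartLabGraph V
  encode := PartLabGraph.encode e
  encode_injective := PartLabGraph.encode_injective e
  value J := (J.Homs H).ncard % p

/-! Delete the pinned vertices of `J`, add a copy of `H`, and join each unpinned vertex to the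
labels of its pinned neighbours. A homomorphism from this graph to `H` is a pair `(y, f)`: an
endomorphism `y` of `H`, and a map `f` on the unpinned vertices for which label `w` stands for `y
w`. If `y` is injective it is an automorphism, and composing `f` with its inverse restores the true
labels. Hence exactly `|Aut H| * N` pairs have injective `y`, where `N` counts the pairs with `y =
id` (`card_isPair_injective`). `N` is the number wanted if all edges between pinned vertices respect
`H`; otherwise the answer is 0 (`ncard_homs`, `ncard_homs_eq_zero`).

Injectivity is imposed by inclusion-exclusion. For a set `E` of pairs of distinct vertices of `H`,
the pairs `(y, f)` with `y` constant on the classes generated by `E` are the homomorphisms from the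
graph in which the copy of `H` is replaced by its quotient (`glueHomEquiv`); there are none if the
quotient has a loop. The sum over `E` with signs `(-1) ^ #E` leaves the injective `y`
(`sum_card_glue`). By Cauchy's theorem `p` does not divide `|Aut H|`, so modulo `p` this factor can
be divided out.

The number of sets `E` depends only on `H`, and each query adds at most `h` vertices. All that a
query needs is the adjacency among unpinned vertices and, for each of them, the set of labels of its
neighbours, which is one symbol of a finite alphabet. The machine stores this while reading the
input (`exec_readRows`), writes the queries (`Gadget.exec_ask`) and sums the answers in a register
of type `ZMod p`. -/

namespace StackProgram

/-! ### Structured stack programs and their compilation to oracle machines -/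

open Turing

/-- Structured programs that act on the tapes (used as stacks) and the finite memory of an oracle
machine. -/
inductive Prog {K : Type} (Γ : K → Type) (σ : Type) : Type
  /-- push `f m` on tape `k`, if `c m` holds for the memory content `m` -/
  | push (k : Port ⊕ K) (c : σ → Bool) (f : σ → TapeAlphabet Γ k) : Prog Γ σ
  /-- change the memory -/
  | load (f : σ → σ) : Prog Γ σ
  | seq (P Q : Prog Γ σ) : Prog Γ σ
  /-- pop a symbol (`none` if the tape is empty), update the memory by `f`, and leave the loop if the
  symbol fails `c`; otherwise execute the body and repeat -/
  | loop (k : Port ⊕ K) (c : Option (TapeAlphabet Γ k) → Bool)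
      (f : σ → Option (TapeAlphabet Γ k) → σ) (P : Prog Γ σ) : Prog Γ σ
  | oracle : Prog Γ σ

variable {K : Type} {Γ : K → Type} {σ : Type}

/-- Memory and tapes. -/
abbrev State (Γ : K → Type) (σ : Type) : Type := σ × (∀ k, List (TapeAlphabet Γ k))

/-- The program labels of the compiled program. -/
def Lab : Prog Γ σ → Type
  | .push _ _ _ => Unit
  | .load _ => Unit
  | .seq P Q => Lab P ⊕ Lab Q
  | .loop _ _ _ P => Option (Lab P)
  | .oracle => Unit

theorem finite_lab : ∀ P : Prog Γ σ, Finite (Lab P)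
  | .push _ _ _ => inferInstanceAs (Finite Unit)
  | .load _ => inferInstanceAs (Finite Unit)
  | .seq P Q =>
    have := finite_lab P
    have := finite_lab Q
    inferInstanceAs (Finite (Lab P ⊕ Lab Q))
  | .loop _ _ _ P =>
    have := finite_lab P
    inferInstanceAs (Finite (Option (Lab P)))
  | .oracle => inferInstanceAs (Finite Unit)

/-- The label at which the compiled program starts. -/
def entry : (P : Prog Γ σ) → Lab P
  | .push _ _ _ => ()
  | .load _ => ()
  | .seq P _ => Sum.inl (entry P)
  | .loop _ _ _ _ => (none : Option _)
  | .oracle => ()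

variable [DecidableEq K]

/-- `Run O P s s' t`: with oracle `O`, the program `P` leads from `s` to `s'` in at most `t` steps. -/
inductive Run (O : List Bool → List Bool) : Prog Γ σ → State Γ σ → State Γ σ → ℕ → Prop
  | push_true {k c f m S} : c m = true →
      Run O (.push k c f) (m, S) (m, Function.update S k (f m :: S k)) 1
  | push_false {k c f m S} : c m = false → Run O (.push k c f) (m, S) (m, S) 1
  | load {f m S} : Run O (.load f) (m, S) (f m, S) 1
  | seq {P Q s s' s'' t t'} : Run O P s s' t → Run O Q s' s'' t' →
      Run O (.seq P Q) s s'' (t + t')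
  | loop_exit {k c f P m S} : c (S k).head? = false →
      Run O (.loop k c f P) (m, S) (f m (S k).head?, Function.update S k (S k).tail) 1
  | loop_step {k c f P m S s' s'' t t'} : c (S k).head? = true →
      Run O P (f m (S k).head?, Function.update S k (S k).tail) s' t →
      Run O (.loop k c f P) s' s'' t' → Run O (.loop k c f P) (m, S) s'' (1 + t + t')
  | oracle {m S} : Run O .oracle (m, S)
      (m, Function.update (Function.update S (.inl .query) []) (.inl .answer)
          (O (S (.inl .query)))) 1
  | weaken {P s s' t t'} : Run O P s s' t → t ≤ t' → Run O P s s' t'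

/-- The instructions of the compiled program. The additional bit in the memory holds the outcome of
the latest loop test. -/
def code {L : Type} : (P : Prog Γ σ) → (Lab P → L) → L → Lab P →
    TM2.Stmt (TapeAlphabet Γ) L (σ × Bool) ⊕ L
  | .push k c f, _, exit => fun _ => .inl (.branch (fun m => c m.1)
      (.push k (fun m => f m.1) (.goto fun _ => exit)) (.goto fun _ => exit))
  | .load f, _, exit => fun _ => .inl (.load (fun m => (f m.1, m.2)) (.goto fun _ => exit))
  | .seq P Q, emb, exit => fun l => Sum.elim
      (code P (fun l => emb (Sum.inl l)) (emb (Sum.inr (entry Q))))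
      (code Q (fun l => emb (Sum.inr l)) exit) l
  | .loop k c f P, emb, exit => fun l => Option.elim l
      (.inl (.pop k (fun m o => (f m.1 o, c o))
        (.branch (fun m => m.2) (.goto fun _ => emb (some (entry P))) (.goto fun _ => exit))))
      (code P (fun l => emb (some l)) (emb none))
  | .oracle, _, exit => fun _ => .inr exit

/-- The machine that executes `P` and halts. -/
noncomputable def machine [Fintype K] [∀ k, Fintype (Γ k)] [Fintype σ] (P : Prog Γ σ) (m : σ) :
    OracleTM where
  K := K
  Γ := Γ
  Λ := Option (Lab P)
  fintypeΛ := have := finite_lab P; Fintype.ofFinite _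
  σ := σ × Bool
  main := some (entry P)
  start := (m, false)
  prog := fun l => Option.elim l (.inl .halt) (code P some none)

/-- Induction on the run. `emb` and `exit` are arbitrary so that the induction hypotheses apply to
subprograms, whose code sits inside a larger program. The memory type is given by an equation so
that, once `M` is taken apart, it can be substituted away. -/
theorem Run.reaches {O : List Bool → List Bool} {M : OracleTM} {P : Prog M.Γ σ} {s s' : State M.Γ σ}
    {t : ℕ} (hrun : Run O P s s' t) (hσ : M.σ = (σ × Bool)) : ∀ (emb : Lab P → M.Λ) (exit : M.Λ),
    (∀ l, M.prog (emb l) = cast (by rw [hσ]) (code P emb exit l)) → ∀ b, ∃ n ≤ t, ∃ b',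
      (M.step O)^[n] ⟨some (emb (entry P)), cast hσ.symm (s.1, b), s.2⟩ =
        ⟨some exit, cast hσ.symm (s'.1, b'), s'.2⟩ := by
  obtain ⟨MK, MΓ, MΛ, Mσ, mm, ms, mp⟩ := M
  dsimp only at hσ P
  subst hσ
  dsimp only [cast_eq]
  induction hrun with
  | @push_true k c f m S h =>
    intro emb exit hl b
    refine ⟨1, le_rfl, b, ?_⟩
    have h1 := hl ()
    simp only [code] at h1
    simp [OracleTM.step, entry, h1, TM2.stepAux, h]
  | @push_false k c f m S h =>
    intro emb exit hl b
    refine ⟨1, le_rfl, b, ?_⟩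
    have h1 := hl ()
    simp only [code] at h1
    simp [OracleTM.step, entry, h1, TM2.stepAux, h]
  | @load f m S =>
    intro emb exit hl b
    refine ⟨1, le_rfl, b, ?_⟩
    have h1 := hl ()
    simp only [code] at h1
    simp [OracleTM.step, entry, h1, TM2.stepAux]
  | @seq P Q s s' s'' t t' _ _ ih1 ih2 =>
    intro emb exit hl b
    obtain ⟨n1, hn1, b1, e1⟩ := ih1 (fun l => emb (Sum.inl l)) (emb (Sum.inr (entry Q)))
      (fun l => hl (Sum.inl l)) b
    obtain ⟨n2, hn2, b2, e2⟩ := ih2 (fun l => emb (Sum.inr l)) exit (fun l => hl (Sum.inr l)) b1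
    refine ⟨n2 + n1, by omega, b2, ?_⟩
    rw [Function.iterate_add_apply]
    exact (congrArg _ e1).trans e2
  | @loop_exit k c f P m S h =>
    intro emb exit hl b
    refine ⟨1, le_rfl, false, ?_⟩
    have h1 := hl none
    simp only [code, Option.elim] at h1
    simp [OracleTM.step, entry, h1, TM2.stepAux, h]
  | @loop_step k c f P m S s' s'' t t' h _ _ ih1 ih2 =>
    intro emb exit hl b
    obtain ⟨n1, hn1, b1, e1⟩ := ih1 (fun l => emb (some l)) (emb none) (fun l => hl (some l)) true
    obtain ⟨n2, hn2, b2, e2⟩ := ih2 emb exit hl b1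
    refine ⟨n2 + (n1 + 1), by omega, b2, ?_⟩
    rw [Function.iterate_add_apply, Function.iterate_add_apply, Function.iterate_one]
    have h1 := hl none
    simp only [code, Option.elim] at h1
    refine Eq.trans (congrArg _ (Eq.trans (congrArg _ ?_) e1)) e2
    simp [OracleTM.step, entry, h1, TM2.stepAux, h]
  | @oracle m S =>
    intro emb exit hl b
    refine ⟨1, le_rfl, b, ?_⟩
    have h1 := hl ()
    simp only [code] at h1
    simp [OracleTM.step, entry, h1]
  | weaken _ hle ih =>
    intro emb exit hl b
    obtain ⟨n, hn, b', e⟩ := ih emb exit hl b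
    exact ⟨n, hn.trans hle, b', e⟩

/-- `OutputsWithin` inspects the configuration after exactly `t` steps; a halted configuration is a
fixed point of `step`. -/
theorem outputsWithin_of_halted {M : OracleTM} {O : List Bool → List Bool} {x y : List Bool}
    {n t : ℕ} (hnt : n ≤ t) (hl : ((M.step O)^[n] (M.initial x)).l = none)
    (hy : ((M.step O)^[n] (M.initial x)).stk (.inl .output) = y) : M.OutputsWithin O x y t := by
  have key : (M.step O)^[t] (M.initial x) = (M.step O)^[n] (M.initial x) := by
    obtain ⟨d, rfl⟩ := Nat.exists_eq_add_of_le' hnt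
    rw [Function.iterate_add_apply]
    generalize (M.step O)^[n] (M.initial x) = c at hl
    obtain ⟨l, v, S⟩ := c
    dsimp only at hl
    subst hl
    exact Function.iterate_fixed rfl d
  exact ⟨by rw [key, hl], by rw [key, hy]⟩

theorem Run.outputsWithin [Fintype K] [∀ k, Fintype (Γ k)] [Fintype σ] {P : Prog Γ σ} {m : σ}
    {O : List Bool → List Bool} {x : List Bool} {s' : State Γ σ} {t : ℕ}
    (hrun : Run O P (m, Function.update (fun _ => []) (.inl .input) x) s' t) :
    (machine P m).OutputsWithin O x (s'.2 (.inl .output)) (t + 1) := by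
  -- The exit label `none` carries the `halt` statement; executing it is the additional step.
  obtain ⟨n, hn, b', e⟩ := Run.reaches (M := machine P m) hrun rfl some none (fun _ => rfl) false
  have e' : ((machine P m).step O)^[n] ((machine P m).initial x) = ⟨some none, (s'.1, b'), s'.2⟩ := e
  refine outputsWithin_of_halted (n := n + 1) (by omega) ?_ ?_
  · rw [Function.iterate_succ_apply', e']
    rfl
  · rw [Function.iterate_succ_apply', e']
    rfl

end StackProgram

/-! ### Tapes and registers of the reduction -/

namespace StackProgram

open Turing

/-- The work tapes of the reduction. -/
inductive WorkTape
  | cnt | labA | labB | labC | masks | masks' | rows | rows'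
  deriving DecidableEq

instance : Fintype WorkTape where
  elems := {.cnt, .labA, .labB, .labC, .masks, .masks', .rows, .rows'}
  complete := by rintro (_ | _) <;> decide

/-- A set of labels. -/
abbrev Mask (h : ℕ) : Type := Fin (h + 1) → Bool

/-- The alphabets of the work tapes. -/
abbrev WorkAlphabet (h : ℕ) : WorkTape → Type
  | .cnt => Bool
  | .labA | .labB | .labC => Fin (h + 1)
  | .masks | .masks' => Mask h
  | .rows | .rows' => Bool ⊕ Mask h

instance (h : ℕ) : ∀ k, Fintype (WorkAlphabet h k) := by
  rintro (_ | _) <;> dsimp only [WorkAlphabet] <;> infer_instance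

/-- The memory: registers. -/
structure Mem (h p : ℕ) where
  /-- label of the current row -/
  row : Fin (h + 1)
  /-- label of the current column -/
  col : Fin (h + 1)
  bit : Bool
  mask : Mask h
  tok : Bool ⊕ Mask h
  wt : ZMod p
  ok : Bool
  acc : ZMod p

noncomputable instance (h p : ℕ) [NeZero p] : Fintype (Mem h p) :=
  Fintype.ofInjective
    (fun m : Mem h p => (m.row, m.col, m.bit, m.mask, m.tok, m.wt, m.ok, m.acc)) (by
      rintro ⟨⟩ ⟨⟩ hm
      simpa using hm)

/-- Memory and tape contents. -/
structure Store (h p : ℕ) where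
  mem : Mem h p
  inp : List Bool
  out : List Bool
  qry : List Bool
  ans : List Bool
  cnt : List Bool
  labA : List (Fin (h + 1))
  labB : List (Fin (h + 1))
  labC : List (Fin (h + 1))
  masks : List (Mask h)
  masks' : List (Mask h)
  rows : List (Bool ⊕ Mask h)
  rows' : List (Bool ⊕ Mask h)

namespace Store

variable {h p : ℕ}

/-- The content of a tape. -/
def stk (s : Store h p) : ∀ k : Port ⊕ WorkTape, List (TapeAlphabet (WorkAlphabet h) k)
  | .inl .input => s.inp
  | .inl .output => s.out
  | .inl .query => s.qry
  | .inl .answer => s.ans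
  | .inr .cnt => s.cnt
  | .inr .labA => s.labA
  | .inr .labB => s.labB
  | .inr .labC => s.labC
  | .inr .masks => s.masks
  | .inr .masks' => s.masks'
  | .inr .rows => s.rows
  | .inr .rows' => s.rows'

/-- Replace the content of a tape. -/
def set (s : Store h p) : ∀ k : Port ⊕ WorkTape, List (TapeAlphabet (WorkAlphabet h) k) → Store h p
  | .inl .input, l => { s with inp := l }
  | .inl .output, l => { s with out := l }
  | .inl .query, l => { s with qry := l }
  | .inl .answer, l => { s with ans := l }
  | .inr .cnt, l => { s with cnt := l }
  | .inr .labA, l => { s with labA := l }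
  | .inr .labB, l => { s with labB := l }
  | .inr .labC, l => { s with labC := l }
  | .inr .masks, l => { s with masks := l }
  | .inr .masks', l => { s with masks' := l }
  | .inr .rows, l => { s with rows := l }
  | .inr .rows', l => { s with rows' := l }

/-- `stk` ignores the registers, so `m` is free and can be chosen to match the memory after the
instruction. -/
theorem update_stk (s : Store h p) (m : Mem h p) (k : Port ⊕ WorkTape)
    (l : List (TapeAlphabet (WorkAlphabet h) k)) :
    Function.update s.stk k l = ({ s.set k l with mem := m } : Store h p).stk := by
  funext k'
  rcases k with (_ | _) | (_ | _) <;> rcases k' with (_ | _) | (_ | _) <;> rfl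

end Store

variable {h p : ℕ} {O : List Bool → List Bool}

/-- Programs for the tapes and registers of the reduction. -/
abbrev RProg (h p : ℕ) : Type := Prog (WorkAlphabet h) (Mem h p)

/-- `Run` for stores. -/
def Exec (O : List Bool → List Bool) (P : RProg h p) (s s' : Store h p) (t : ℕ) : Prop :=
  Run O P (s.mem, s.stk) (s'.mem, s'.stk) t

namespace Exec

theorem weaken {P : RProg h p} {s s' : Store h p} {t t' : ℕ} (H : Exec O P s s' t) (ht : t ≤ t') :
    Exec O P s s' t' :=
  Run.weaken H ht

theorem seq {P Q : RProg h p} {s s' s'' : Store h p} {t t' : ℕ} (H : Exec O P s s' t)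
    (H' : Exec O Q s' s'' t') : Exec O (.seq P Q) s s'' (t + t') :=
  Run.seq H H'

theorem push (k : Port ⊕ WorkTape) (c : Mem h p → Bool)
    (f : Mem h p → TapeAlphabet (WorkAlphabet h) k) (s : Store h p) :
    Exec O (.push k c f) s (if c s.mem then s.set k (f s.mem :: s.stk k) else s) 1 := by
  by_cases hc : c s.mem = true
  · rw [if_pos hc]
    have := Run.push_true (O := O) (k := k) (f := f) (S := s.stk) hc
    rw [Store.update_stk s s.mem] at this
    convert this using 3
    all_goals rcases k with (_ | _) | (_ | _) <;> rfl
  · rw [if_neg hc]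
    exact Run.push_false (by simpa using hc)

theorem load (f : Mem h p → Mem h p) (s : Store h p) :
    Exec O (.load f) s { s with mem := f s.mem } 1 :=
  Run.load

theorem loop_exit {k : Port ⊕ WorkTape} {c : Option (TapeAlphabet (WorkAlphabet h) k) → Bool}
    {f : Mem h p → Option (TapeAlphabet (WorkAlphabet h) k) → Mem h p} {P : RProg h p}
    {s : Store h p} (hc : c (s.stk k).head? = false) :
    Exec O (.loop k c f P) s { s.set k (s.stk k).tail with mem := f s.mem (s.stk k).head? } 1 := by
  have := Run.loop_exit (O := O) (f := f) (P := P) (m := s.mem) hc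
  rwa [Store.update_stk s (f s.mem (s.stk k).head?)] at this

theorem loop_step {k : Port ⊕ WorkTape} {c : Option (TapeAlphabet (WorkAlphabet h) k) → Bool}
    {f : Mem h p → Option (TapeAlphabet (WorkAlphabet h) k) → Mem h p} {P : RProg h p}
    {s s' s'' : Store h p} {t t' : ℕ} (hc : c (s.stk k).head? = true)
    (H : Exec O P { s.set k (s.stk k).tail with mem := f s.mem (s.stk k).head? } s' t)
    (H' : Exec O (.loop k c f P) s' s'' t') : Exec O (.loop k c f P) s s'' (1 + t + t') := by
  refine Run.loop_step hc ?_ H'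
  rwa [Store.update_stk s (f s.mem (s.stk k).head?)]

theorem oracle (s : Store h p) :
    Exec O .oracle s { s with qry := [], ans := O s.qry } 1 := by
  have := Run.oracle (O := O) (m := s.mem) (S := s.stk)
  rw [Store.update_stk s s.mem, Store.update_stk _ s.mem] at this
  exact this

end Exec

namespace Exec

theorem push_eq {k : Port ⊕ WorkTape} {c : Mem h p → Bool}
    {f : Mem h p → TapeAlphabet (WorkAlphabet h) k} {s s' : Store h p}
    (hs : s' = if c s.mem then s.set k (f s.mem :: s.stk k) else s) :
    Exec O (.push k c f) s s' 1 :=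
  hs ▸ Exec.push k c f s

theorem load_eq {f : Mem h p → Mem h p} {s s' : Store h p} (hs : s' = { s with mem := f s.mem }) :
    Exec O (.load f) s s' 1 :=
  hs ▸ Exec.load f s

theorem of_eq {P : RProg h p} {s s₁ s' s₁' : Store h p} {t t' : ℕ} (H : Exec O P s₁ s₁' t)
    (hs : s = s₁) (hs' : s' = s₁') (ht : t ≤ t') : Exec O P s s' t' := by
  subst hs hs'
  exact H.weaken ht

/-- Execution of a loop that runs through the list `l`. The store `st pre suf` describes the
situation when the part `pre` of `l` has been treated and `suf` remains. -/
theorem loop_list {ι : Type*} {k : Port ⊕ WorkTape}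
    {c : Option (TapeAlphabet (WorkAlphabet h) k) → Bool}
    {f : Mem h p → Option (TapeAlphabet (WorkAlphabet h) k) → Mem h p} {P : RProg h p}
    {s s' : Store h p} {T T' : ℕ}
    (φ : ι → TapeAlphabet (WorkAlphabet h) k) (rest : List (TapeAlphabet (WorkAlphabet h) k))
    (st : List ι → List ι → Store h p) (l : List ι)
    (hs : s = st [] l)
    (hs' : s' = { (st l []).set k rest.tail with mem := f (st l []).mem rest.head? })
    (hT : l.length * (T + 1) + 1 ≤ T')
    (hstk : ∀ pre suf, (st pre suf).stk k = suf.map φ ++ rest)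
    (hc : ∀ a, c (some (φ a)) = true) (hexit : c rest.head? = false)
    (hbody : ∀ pre a suf, Exec O P
      { (st pre (a :: suf)).set k (suf.map φ ++ rest) with
        mem := f (st pre (a :: suf)).mem (some (φ a)) } (st (pre ++ [a]) suf) T) :
    Exec O (.loop k c f P) s s' T' := by
  -- Each round costs `T` steps for the body and one for the pop; the final `+ 1` is the pop that
  -- leaves the loop.
  have key : ∀ suf pre, Exec O (.loop k c f P) (st pre suf)
      { (st (pre ++ suf) []).set k rest.tail with mem := f (st (pre ++ suf) []).mem rest.head? }
      (suf.length * (T + 1) + 1) := by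
    intro suf
    induction suf with
    | nil =>
      intro pre
      have h1 : (st pre []).stk k = rest := by simp [hstk]
      have := Exec.loop_exit (O := O) (f := f) (P := P) (s := st pre []) (by rwa [h1])
      rw [h1] at this
      simpa using this
    | cons a suf ih =>
      intro pre
      have h1 : (st pre (a :: suf)).stk k = φ a :: (suf.map φ ++ rest) := by simp [hstk]
      have h2 := hbody pre a suf
      have h3 := ih (pre ++ [a])
      rw [List.append_assoc, List.singleton_append] at h3
      refine (Exec.loop_step (t := T) (by rw [h1]; exact hc a) ?_ h3).weaken
        (by rw [List.length_cons]; linarith)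
      rw [h1]
      exact h2
  subst hs hs'
  exact (key l []).weaken hT

end Exec

/-! ### Reading the input -/

/-- The memory with all auxiliary registers cleared. -/
def Mem.clean (ok : Bool) (acc : ZMod p) : Mem h p :=
  ⟨0, 0, false, fun _ => false, .inl false, 0, ok, acc⟩

/-- The condition that always holds. -/
def always : Mem h p → Bool := fun _ => true

/-- The program that does nothing. -/
def skip : RProg h p := .load id

theorem exec_skip (s : Store h p) : Exec O skip s s 1 := Exec.load id s

/-- Clear the auxiliary registers. -/
def tidy : RProg h p := .load fun m => .clean m.ok m.acc

/-- Reads a unary code from the input and stores it on the tape `cnt`. -/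
def readSize : RProg h p :=
  .loop (.inl .input) (· == some true) (fun m _ => m) (.push (.inr .cnt) always (fun _ => true))

theorem exec_readSize (s : Store h p) {n : ℕ} {r : List Bool} (hinp : s.inp = unaryCode n ++ r)
    (hcnt : s.cnt = []) :
    Exec O readSize s { s with inp := r, cnt := List.replicate n true } (2 * n + 1) := by
  rcases s with ⟨m, inp, out, qry, ans, cnt, labA, labB, labC, masks, masks', rows, rows'⟩
  dsimp only at hinp hcnt
  subst hinp hcnt
  -- The closing `false` of the unary code is consumed by the failing test.
  refine Exec.loop_list (T := 1) (fun _ : Unit => true) (false :: r)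
    (fun pre suf => ⟨m, suf.map (fun _ => true) ++ (false :: r), out, qry, ans,
      (pre.map (fun _ => true)).reverse, labA, labB, labC, masks, masks', rows, rows'⟩)
    (List.replicate n ()) ?_ ?_ ?_ (fun _ _ => rfl) (fun _ => rfl) rfl (fun pre a suf => ?_)
  · simp [unaryCode]
  · simp [Store.set]
  · simp; linarith
  · exact Exec.push_eq (by simp [always, Store.set, Store.stk, ← List.replicate_succ])

/-- Reads one unary code from the input into the register `row`. -/
def readLabel : RProg h p :=
  .loop (.inl .input) (· == some true)
    (fun m o => if o = some true then { m with row := m.row + 1 } else m) skip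

theorem exec_readLabel (s : Store h p) (a : Fin (h + 1)) {r : List Bool}
    (hinp : s.inp = unaryCode a ++ r) (hrow : s.mem.row = 0) :
    Exec O readLabel s { s with inp := r, mem := { s.mem with row := a } } (2 * h + 1) := by
  rcases s with ⟨⟨row, col, bit, mask, tok, wt, ok, acc⟩, inp, out, qry, ans, cnt, labA, labB, labC,
    masks, masks', rows, rows'⟩
  dsimp only at hinp hrow
  subst hinp hrow
  refine Exec.loop_list (T := 1) (fun _ : Unit => true) (false :: r)
    -- The invariant is stated for all `pre`, so the counter is taken modulo `h + 1`; at the end it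
    -- is exactly `a`, because `a ≤ h`.
    (fun pre suf => ⟨⟨Fin.ofNat (h + 1) pre.length, col, bit, mask, tok, wt, ok, acc⟩,
      suf.map (fun _ => true) ++ (false :: r), out, qry, ans, cnt, labA, labB, labC, masks, masks',
      rows, rows'⟩)
    (List.replicate a ()) ?_ ?_ ?_ (fun _ _ => rfl) (fun _ => rfl) rfl (fun pre a suf => ?_)
  · simp [unaryCode]
  · simp [Store.set]
  · have := a.is_le
    simp only [List.length_replicate]
    omega
  · convert exec_skip _ using 1
    simp [Store.set, Fin.ext_iff, Fin.val_add]

/-- Reads the labels of all vertices and stores them on the tape `labB`, in reverse order. -/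
def readLabels : RProg h p :=
  .loop (.inr .cnt) Option.isSome (fun m _ => m)
    (.seq readLabel (.seq (.push (.inr .labB) always (fun m => m.row)) tidy))

theorem exec_readLabels {ι : Type*} (s : Store h p) (js : List ι) (lab : ι → Fin (h + 1))
    {r : List Bool} {ok : Bool} {acc : ZMod p} (hmem : s.mem = .clean ok acc)
    (hcnt : s.cnt = List.replicate js.length true)
    (hinp : s.inp = (js.flatMap fun j => unaryCode (lab j)) ++ r) (hB : s.labB = []) :
    Exec O readLabels s { s with inp := r, cnt := [], labB := (js.map lab).reverse }
      (js.length * (2 * h + 4) + 1) := by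
  rcases s with ⟨m, inp, out, qry, ans, cnt, labA, labB, labC, masks, masks', rows, rows'⟩
  dsimp only at hmem hcnt hinp hB
  subst hmem hcnt hinp hB
  refine Exec.loop_list (T := 2 * h + 1 + (1 + 1)) (fun _ : ι => true) []
    (fun pre suf => ⟨.clean ok acc, (suf.flatMap fun j => unaryCode (lab j)) ++ r, out, qry, ans,
      suf.map (fun _ => true) ++ [], labA, (pre.map lab).reverse, labC, masks, masks', rows, rows'⟩)
    js ?_ ?_ ?_ (fun _ _ => rfl) (fun _ => rfl) rfl (fun pre a suf => ?_)
  · simp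
  · simp [Store.set]
  · linarith
  · exact (exec_readLabel _ (lab a) (r := (suf.flatMap fun j => unaryCode (lab j)) ++ r)
      (by simp [Store.set]) rfl).seq (.seq (.push_eq rfl) (.load_eq (by
        simp [always, Store.set, Store.stk, Mem.clean])))

/-- Moves the list of labels to `labA` and `labC`, restoring its order. -/
def copyLabels : RProg h p :=
  .loop (.inr .labB) Option.isSome (fun m o => { m with row := o.getD 0 })
    (.seq (.push (.inr .labA) always (fun m => m.row))
      (.seq (.push (.inr .labC) always (fun m => m.row)) tidy))

theorem exec_copyLabels (s : Store h p) {ok : Bool} {acc : ZMod p} (hmem : s.mem = .clean ok acc)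
    (hA : s.labA = []) (hC : s.labC = []) :
    Exec O copyLabels s { s with labA := s.labB.reverse, labB := [], labC := s.labB.reverse }
      (s.labB.length * 4 + 1) := by
  rcases s with ⟨m, inp, out, qry, ans, cnt, labA, labB, labC, masks, masks', rows, rows'⟩
  dsimp only at hmem hA hC
  subst hmem hA hC
  refine Exec.loop_list (T := 1 + (1 + 1)) (fun a => a) []
    (fun pre suf => ⟨.clean ok acc, inp, out, qry, ans, cnt, pre.reverse, suf.map (fun a => a) ++ [],
      pre.reverse, masks, masks', rows, rows'⟩)
    labB ?_ ?_ ?_ (fun _ _ => rfl) (fun _ => rfl) rfl (fun pre a suf => ?_)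
  · simp
  · simp [Store.set, Mem.clean]
  · linarith
  · exact .seq (.push_eq rfl) (.seq (.push_eq rfl) (.load_eq (by
      simp [always, Store.set, Store.stk, Mem.clean])))

/-- Reads the part of the current row of the adjacency matrix that is described by `labA`. -/
def scanRow : RProg h p :=
  .loop (.inr .labA) Option.isSome (fun m o => { m with col := o.getD 0, bit := false })
    (.seq (.loop (.inl .input) (fun _ => false)
        (fun m o => { m with
          bit := o.getD false, mask := fun l => m.mask l || (o.getD false && l == m.col) }) skip)
      (.seq (.push (.inr .labB) always (fun m => m.col))
        (.push (.inr .rows) (fun m => m.row == 0 && m.col == 0) (fun m => .inl m.bit))))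

theorem exec_scanRow {ι : Type*} (s : Store h p) (js : List ι) (lab : ι → Fin (h + 1)) (a : ι → Bool)
    {r : List Bool} (hcol : s.mem.col = 0) (hbit : s.mem.bit = false)
    (hA : s.labA = js.map lab) (hinp : s.inp = js.map a ++ r) (hB : s.labB = []) :
    Exec O scanRow s
      { s with
        inp := r, labA := [], labB := (js.map lab).reverse
        rows := ((js.filter fun j => s.mem.row == 0 && lab j == 0).map
          fun j => (.inl (a j) : Bool ⊕ Mask h)).reverse ++ s.rows
        mem := { s.mem with
          mask := fun l => s.mem.mask l || js.any fun j => a j && l == lab j } }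
      (js.length * 4 + 1) := by
  rcases s with ⟨⟨row, col, bit, mask, tok, wt, ok, acc⟩, inp, out, qry, ans, cnt, labA, labB, labC,
    masks, masks', rows, rows'⟩
  dsimp only at hcol hbit hA hinp hB
  subst hcol hbit hA hinp hB
  refine Exec.loop_list (T := 1 + (1 + 1)) lab []
    -- `col` and `bit` hold the last entry treated; popping the empty tape on exit resets them to
    -- the defaults.
    (fun pre suf => ⟨⟨row, (pre.getLast?.map lab).getD 0, (pre.getLast?.map a).getD false,
        fun l => mask l || pre.any fun j => a j && l == lab j, tok, wt, ok, acc⟩,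
      suf.map a ++ r, out, qry, ans, cnt, suf.map lab ++ [], (pre.map lab).reverse, labC,
      masks, masks', ((pre.filter fun j => row == 0 && lab j == 0).map
          fun j => (.inl (a j) : Bool ⊕ Mask h)).reverse ++ rows, rows'⟩)
    js ?_ ?_ ?_ (fun _ _ => rfl) (fun _ => rfl) rfl (fun pre a suf => ?_)
  · simp
  · simp [Store.set]
  · linarith
  -- A loop whose test always fails is a single pop, here of one matrix entry.
  · refine .seq (.loop_exit rfl) (.seq (.push_eq rfl) (.push_eq ?_))
    by_cases h1 : row = 0 <;> by_cases h2 : lab a = 0 <;>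
      simp [always, Store.set, Store.stk, h1, h2, Bool.or_assoc]

/-- Moves the labels from `labB` back to `labA`. -/
def restoreLabels : RProg h p :=
  .loop (.inr .labB) Option.isSome (fun m o => { m with col := o.getD 0 })
    (.push (.inr .labA) always (fun m => m.col))

theorem exec_restoreLabels (s : Store h p) (hcol : s.mem.col = 0) (hA : s.labA = []) :
    Exec O restoreLabels s { s with labA := s.labB.reverse, labB := [] }
      (s.labB.length * 2 + 1) := by
  rcases s with ⟨⟨row, col, bit, mask, tok, wt, ok, acc⟩, inp, out, qry, ans, cnt, labA, labB, labC,
    masks, masks', rows, rows'⟩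
  dsimp only at hcol hA
  subst hcol hA
  refine Exec.loop_list (T := 1) (fun a => a) []
    (fun pre suf => ⟨⟨row, pre.getLast?.getD 0, bit, mask, tok, wt, ok, acc⟩,
      inp, out, qry, ans, cnt, pre.reverse, suf.map (fun a => a) ++ [], labC,
      masks, masks', rows, rows'⟩)
    labB ?_ ?_ ?_ (fun _ _ => rfl) (fun _ => rfl) rfl (fun pre a suf => ?_)
  · simp
  · simp [Store.set]
  · linarith
  · exact .push_eq (by simp [always, Store.set, Store.stk])

/-- Reads the adjacency matrix. -/
def readRows (compat : Fin (h + 1) → Fin (h + 1) → Bool) : RProg h p :=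
  .loop (.inr .labC) Option.isSome (fun m o => { m with row := o.getD 0 })
    (.seq scanRow (.seq restoreLabels
      (.seq (.push (.inr .rows) (fun m => m.row == 0) (fun m => .inr m.mask))
        (.seq (.push (.inr .masks) (fun m => m.row == 0) (fun m => m.mask))
          (.load fun m => .clean (m.ok && decide (∀ l, m.mask l → compat m.row l)) m.acc)))))

/-- The rows `is` and the columns `js` are separate lists because the induction consumes only the
rows. On the tape `rows`, the bits of an unpinned row lie below its mask, so that from bottom to top
each row is followed by the symbol that yields its gadget columns. -/
theorem exec_readRows {ι : Type*} (compat : Fin (h + 1) → Fin (h + 1) → Bool) (s : Store h p)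
    (is js : List ι) (lab : ι → Fin (h + 1)) (a : ι → ι → Bool) (μ : ι → Mask h)
    (hμ : ∀ i l, μ i l = js.any fun j => a i j && l == lab j)
    {r : List Bool} {ok : Bool} {acc : ZMod p} (hmem : s.mem = .clean ok acc)
    (hinp : s.inp = (is.flatMap fun i => js.map (a i)) ++ r)
    (hA : s.labA = js.map lab) (hB : s.labB = []) (hC : s.labC = is.map lab) (hM : s.masks = [])
    (hR : s.rows = []) :
    Exec O (readRows compat) s
      { s with
        inp := r, labC := []
        rows := (is.filter (lab · == 0)).reverse.flatMap fun i =>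
          (.inr (μ i) : Bool ⊕ Mask h) :: (js.filter (lab · == 0)).reverse.map (fun j => .inl (a i j))
        masks := ((is.filter (lab · == 0)).map μ).reverse
        mem := .clean (ok && is.all fun i => decide (∀ l, μ i l → compat (lab i) l)) acc }
      (is.length * (js.length * 6 + 6) + 1) := by
  rcases s with ⟨m, inp, out, qry, ans, cnt, labA, labB, labC, masks, masks', rows, rows'⟩
  dsimp only at hmem hA hinp hB hC hM hR
  subst hmem hA hinp hB hC hM hR
  refine Exec.loop_list (T := (js.length * 4 + 1) + ((js.length * 2 + 1) + (1 + (1 + 1)))) lab []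
    (fun pre suf => ⟨.clean (ok && pre.all fun i => decide (∀ l, μ i l → compat (lab i) l)) acc,
      (suf.flatMap fun i => js.map (a i)) ++ r, out, qry, ans, cnt, js.map lab, [],
      suf.map lab ++ [], ((pre.filter (lab · == 0)).map μ).reverse, masks',
      (pre.filter (lab · == 0)).reverse.flatMap fun i =>
          (.inr (μ i) : Bool ⊕ Mask h) :: (js.filter (lab · == 0)).reverse.map (fun j => .inl (a i j)),
      rows'⟩)
    is ?_ ?_ ?_ (fun _ _ => rfl) (fun _ => rfl) rfl (fun pre i suf => ?_)
  · simp
  · simp [Store.set, Mem.clean]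
  · linarith
  · refine .seq (exec_scanRow _ js lab (a i) (r := (suf.flatMap fun i => js.map (a i)) ++ r)
        rfl rfl rfl (by simp [Store.set]) rfl)
      (.seq ((exec_restoreLabels _ rfl rfl).weaken (by simp))
        (.seq (.push_eq rfl) (.seq (.push_eq rfl) (.load_eq ?_))))
    have hμ' : μ i = fun l => js.any fun j => a i j && l == lab j := funext (hμ i)
    by_cases h1 : lab i = 0 <;>
      simp [Store.set, Store.stk, h1, hμ', Mem.clean, Bool.and_assoc]

/-! ### Writing the queries and summing the answers -/

/-- A graph on the vertices `ws`, to be attached to the unpinned vertices: `w` is adjacent to an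
unpinned vertex whose pinned neighbours have the set `μ` of labels if `nbr w μ` holds. The number
`coef` is the weight of the resulting graph in a linear combination of homomorphism counts. -/
structure Gadget (h : ℕ) where
  W : Type
  ws : List W
  nbr : W → Mask h → Bool
  adj : W → W → Bool
  coef : ℤ

/-- The encoding of the graph obtained by attaching `g` to the graph with vertices `U` and adjacency
`a`. -/
def Gadget.attachCode (g : Gadget h) {ι : Type*} (U : List ι) (a : ι → ι → Bool) (μ : ι → Mask h) :
    List Bool :=
  unaryCode (U.length + g.ws.length) ++
    ((U.flatMap fun i => U.map (a i) ++ g.ws.map fun w => g.nbr w (μ i)) ++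
      g.ws.flatMap fun w => (U.map fun i => g.nbr w (μ i)) ++ g.ws.map (g.adj w))

/-- Writes a word on the query tape if the memory satisfies `c`. -/
def pushAll (c : Mem h p → Bool) : List (Mem h p → Bool) → RProg h p
  | [] => skip
  | f :: fs => .seq (pushAll c fs) (.push (.inl .query) c f)

/-- The top of the stack is the head of the word, hence the tail is pushed first. -/
theorem exec_pushAll (c : Mem h p → Bool) (fs : List (Mem h p → Bool)) (s : Store h p) :
    Exec O (pushAll c fs) s
      { s with qry := (if c s.mem then fs.map fun f => f s.mem else []) ++ s.qry }
      (fs.length + 1) := by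
  induction fs with
  | nil =>
    have := exec_skip (O := O) s
    simpa [pushAll]
  | cons f fs ih =>
    refine Exec.seq ih (.push_eq ?_)
    by_cases hc : c s.mem <;> simp [hc, Store.set, Store.stk]

/-- Writes one bit on the query tape for each entry of the tape `masks`. -/
def pushMasks (q : Mask h → Bool) : RProg h p :=
  .seq
    (.loop (.inr .masks) Option.isSome (fun m o => { m with mask := o.getD fun _ => false })
      (.seq (.push (.inl .query) always fun m => q m.mask)
        (.seq (.push (.inr .masks') always fun m => m.mask) tidy)))
    (.loop (.inr .masks') Option.isSome (fun m o => { m with mask := o.getD fun _ => false })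
      (.seq (.push (.inr .masks) always fun m => m.mask) tidy))

theorem exec_pushMasks (q : Mask h → Bool) (s : Store h p) {ok : Bool} {acc : ZMod p}
    (hmem : s.mem = .clean ok acc) (hM' : s.masks' = []) :
    Exec O (pushMasks q) s { s with qry := (s.masks.map q).reverse ++ s.qry }
      (s.masks.length * 7 + 2) := by
  rcases s with ⟨m, inp, out, qry, ans, cnt, labA, labB, labC, masks, masks', rows, rows'⟩
  dsimp only at hmem hM'
  subst hmem hM'
  have h1 : Exec O
      (.loop (.inr .masks) Option.isSome (fun m o => { m with mask := o.getD fun _ => false })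
        (.seq (.push (.inl .query) always fun m => q m.mask)
          (.seq (.push (.inr .masks') always fun m => m.mask) tidy)))
      ⟨.clean ok acc, inp, out, qry, ans, cnt, labA, labB, labC, masks, [], rows, rows'⟩
      ⟨.clean ok acc, inp, out, (masks.map q).reverse ++ qry, ans, cnt, labA, labB, labC, [],
        masks.reverse, rows, rows'⟩ (masks.length * 4 + 1) := by
    refine Exec.loop_list (T := 1 + (1 + 1)) (fun a => a) []
      (fun pre suf => ⟨.clean ok acc, inp, out, (pre.map q).reverse ++ qry, ans, cnt, labA, labB,
        labC, suf.map (fun a => a) ++ [], pre.reverse, rows, rows'⟩)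
      masks ?_ ?_ ?_ (fun _ _ => rfl) (fun _ => rfl) rfl (fun pre a suf => ?_)
    · simp
    · simp [Store.set, Mem.clean]
    · linarith
    · exact .seq (.push_eq rfl) (.seq (.push_eq rfl) (.load_eq (by
        simp [always, Store.set, Store.stk, Mem.clean])))
  -- The second loop moves the masks back, so that the tape is intact for later rows and gadgets.
  refine (h1.seq (t' := masks.length * 3 + 1) ?_).weaken (by linarith)
  refine Exec.loop_list (T := 1 + 1) (fun a => a) []
    (fun pre suf => ⟨.clean ok acc, inp, out, (masks.map q).reverse ++ qry, ans, cnt, labA, labB,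
      labC, pre.reverse, suf.map (fun a => a) ++ [], rows, rows'⟩)
    masks.reverse ?_ ?_ ?_ (fun _ _ => rfl) (fun _ => rfl) rfl (fun pre a suf => ?_)
  · simp
  · simp [Store.set, Mem.clean]
  · simp only [List.length_reverse]
    linarith
  · exact .seq (.push_eq rfl) (.load_eq (by simp [always, Store.set, Store.stk, Mem.clean]))

namespace Gadget

variable (g : Gadget h)

/-- Writes the rows of the gadget vertices. -/
def pushGadgetRows : List g.W → RProg h p
  | [] => skip
  | w :: l => .seq (pushGadgetRows l)
    (.seq (pushAll always (g.ws.map fun w' _ => g.adj w w')) (pushMasks (g.nbr w)))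

theorem exec_pushGadgetRows (l : List g.W) (s : Store h p) {ok : Bool} {acc : ZMod p}
    (hmem : s.mem = .clean ok acc) (hM' : s.masks' = []) :
    Exec O (g.pushGadgetRows l) s
      { s with qry :=
          (l.flatMap fun w => (s.masks.map (g.nbr w)).reverse ++ g.ws.map (g.adj w)) ++ s.qry }
      (1 + l.length * (g.ws.length + s.masks.length * 7 + 3)) := by
  induction l with
  | nil =>
    have := exec_skip (O := O) s
    simpa [pushGadgetRows]
  | cons w l ih =>
    refine Exec.of_eq (ih.seq ((exec_pushAll _ _ _).seq (exec_pushMasks _ _ hmem hM'))) rfl ?_ ?_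
    · simp [always, Function.comp_def]
    · simp only [List.length_map, List.length_cons]
      linarith

/-- The bits of an unpinned row that are described by a symbol on the tape `rows`. -/
def symbolBits : Bool ⊕ Mask h → List Bool
  | .inl b => [b]
  | .inr μ => g.ws.map fun w => g.nbr w μ

/-- Writes the rows of the unpinned vertices. -/
def pushRows : RProg h p :=
  .seq
    (.loop (.inr .rows) Option.isSome (fun m o => { m with tok := o.getD (.inl false) })
      (.seq (pushAll (fun m => m.tok.isRight)
          (g.ws.map fun w m => g.nbr w (m.tok.getRight?.getD fun _ => false)))
        (.seq (.push (.inl .query) (fun m => m.tok.isLeft) fun m => m.tok.getLeft?.getD false)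
          (.seq (.push (.inr .rows') always fun m => m.tok) tidy))))
    (.loop (.inr .rows') Option.isSome (fun m o => { m with tok := o.getD (.inl false) })
      (.seq (.push (.inr .rows) always fun m => m.tok) tidy))

theorem exec_pushRows (s : Store h p) {ok : Bool} {acc : ZMod p}
    (hmem : s.mem = .clean ok acc) (hR' : s.rows' = []) :
    Exec O g.pushRows s { s with qry := s.rows.reverse.flatMap g.symbolBits ++ s.qry }
      (s.rows.length * (g.ws.length + 8) + 2) := by
  rcases s with ⟨m, inp, out, qry, ans, cnt, labA, labB, labC, masks, masks', rows, rows'⟩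
  dsimp only at hmem hR'
  subst hmem hR'
  refine Exec.weaken (t := rows.length * (g.ws.length + 5) + 1 + (rows.length * 3 + 1)) (Exec.seq
    (s' := ⟨.clean ok acc, inp, out, rows.reverse.flatMap g.symbolBits ++ qry, ans, cnt, labA, labB,
      labC, masks, masks', [], rows.reverse⟩) ?_ ?_) (by linarith)
  · refine Exec.loop_list (T := (g.ws.length + 1) + (1 + (1 + 1))) (fun a => a) []
      (fun pre suf => ⟨.clean ok acc, inp, out, pre.reverse.flatMap g.symbolBits ++ qry, ans, cnt,
        labA, labB, labC, masks, masks', suf.map (fun a => a) ++ [], pre.reverse⟩)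
      rows ?_ ?_ ?_ (fun _ _ => rfl) (fun _ => rfl) rfl (fun pre a suf => ?_)
    · simp
    · simp [Store.set, Mem.clean]
    · linarith
    · refine .seq ((exec_pushAll _ _ _).weaken (by simp)) (.seq (.push_eq rfl) (.seq (.push_eq rfl)
        (.load_eq ?_)))
      -- Of the two conditional writes only the one that matches the kind of the symbol takes
      -- effect.
      rcases a with b | μ <;>
        simp [always, Store.set, Store.stk, Mem.clean, symbolBits, Function.comp_def]
  · refine Exec.loop_list (T := 1 + 1) (fun a => a) []
      (fun pre suf => ⟨.clean ok acc, inp, out, rows.reverse.flatMap g.symbolBits ++ qry, ans, cnt,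
        labA, labB, labC, masks, masks', pre.reverse, suf.map (fun a => a) ++ []⟩)
      rows.reverse ?_ ?_ ?_ (fun _ _ => rfl) (fun _ => rfl) rfl (fun pre a suf => ?_)
    · simp
    · simp [Store.set, Mem.clean]
    · simp only [List.length_reverse]
      linarith
    · exact .seq (.push_eq rfl) (.load_eq (by simp [always, Store.set, Store.stk, Mem.clean]))

/-- Adds `wt` times the number on the answer tape to `acc`. -/
def addAnswer : RProg h p :=
  .loop (.inl .answer) Option.isSome
    (fun m o => o.elim { m with wt := 0 }
      fun b => { m with wt := 2 * m.wt, acc := m.acc + if b then m.wt else 0 }) skip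

/-- The least significant bit is on top, so `wt` runs through `w`, `2w`, `4w`, … and is added
whenever the bit is set. -/
theorem exec_addAnswer (v : ℕ) (s : Store h p) {ok : Bool} {w acc : ZMod p}
    (hmem : s.mem = { Mem.clean ok acc with wt := w }) (hans : s.ans = Nat.bits v) :
    Exec O addAnswer s { s with ans := [], mem := .clean ok (acc + w * v) } (v.size * 2 + 1) := by
  rcases s with ⟨m, inp, out, qry, ans, cnt, labA, labB, labC, masks, masks', rows, rows'⟩
  dsimp only at hmem hans
  subst hmem hans
  -- This recursion excludes leading zeros, so each case adds exactly one bit to `Nat.bits`.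
  induction v using Nat.binaryRec' generalizing w acc with
  | zero =>
    exact (Exec.loop_exit rfl).of_eq rfl (by simp [Store.set, Store.stk, Mem.clean]) (by simp)
  | bit b v hb ih =>
    rw [Nat.bits_append_bit v b hb]
    have hs : (Nat.bit b v).size = v.size + 1 := by
      rw [← Nat.size_eq_bits_len, ← Nat.size_eq_bits_len, Nat.bits_append_bit v b hb,
        List.length_cons]
    refine Exec.weaken (t := 1 + 1 + (v.size * 2 + 1)) (Exec.loop_step rfl (exec_skip _) ?_)
      (by rw [hs]; linarith)
    refine (@ih (2 * w) (acc + if b then w else 0)).of_eq rfl ?_ le_rfl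
    cases b <;> simp [Nat.bit, Mem.clean] <;> ring

/-- Attaches the gadget, asks the oracle and processes the answer. -/
def ask : RProg h p :=
  .seq (g.pushGadgetRows g.ws) (.seq g.pushRows
    (.seq (.push (.inl .query) always fun _ => false) (.seq (pushMasks fun _ => true)
      (.seq (pushAll always (g.ws.map fun _ _ => true)) (.seq .oracle
        (.seq (.load fun m => { m with wt := (g.coef : ZMod p) }) addAnswer))))))

/-- Reversing the tape undoes both reversals made while reading. `U'` is separate from `U` since
only the rows are consumed by the induction. -/
theorem flatMap_symbolBits {ι : Type*} (U U' : List ι) (a : ι → ι → Bool) (μ : ι → Mask h) :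
    (U.reverse.flatMap fun i => (.inr (μ i) : Bool ⊕ Mask h) ::
        U'.reverse.map (fun j => .inl (a i j))).reverse.flatMap g.symbolBits =
      U.flatMap fun i => U'.map (a i) ++ g.ws.map fun w => g.nbr w (μ i) := by
  have h1 : ∀ l : List ι, ∀ b : ι → Bool,
      (l.map fun j => (.inl (b j) : Bool ⊕ Mask h)).flatMap g.symbolBits = l.map b := by
    intro l b
    induction l with
    | nil => rfl
    | cons j l ih => simp [ih, symbolBits]
  induction U with
  | nil => rfl
  | cons i U ih =>
    rw [List.reverse_cons, List.flatMap_append, List.reverse_append, List.flatMap_append, ih]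
    have h2 := h1 U' (a i)
    simp [← List.map_reverse, h2, symbolBits]

/-- The query is a stack, hence written from its end: gadget rows, unpinned rows, the `false` that
ends the unary size, then one `true` per vertex. The stored tapes are left as they were, so further
gadgets can follow. -/
theorem exec_ask {ι : Type*} (s : Store h p) (U : List ι) (a : ι → ι → Bool) (μ : ι → Mask h) {v : ℕ}
    {ok : Bool} {acc : ZMod p} (hmem : s.mem = .clean ok acc) (hM : s.masks = (U.map μ).reverse)
    (hM' : s.masks' = []) (hR' : s.rows' = [])
    (hR : s.rows = U.reverse.flatMap fun i =>
          (.inr (μ i) : Bool ⊕ Mask h) :: U.reverse.map (fun j => .inl (a i j)))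
    (hq : s.qry = []) (hans : s.ans = []) (hv : O (g.attachCode U a μ) = Nat.bits v) :
    Exec O g.ask s { s with mem := .clean ok (acc + g.coef * v) }
      (g.ws.length * (g.ws.length + U.length * 7 + 4) +
        U.length * (U.length + 1) * (g.ws.length + 8) + U.length * 7 + v.size * 2 + 11) := by
  rcases s with ⟨m, inp, out, qry, ans, cnt, labA, labB, labC, masks, masks', rows, rows'⟩
  dsimp only at hmem hM hM' hR' hR hq hans
  subst hmem hM hM' hR' hq hans
  let st : List Bool → Store h p := fun q => ⟨.clean ok acc, inp, out, q, [], cnt, labA, labB, labC,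
    (U.map μ).reverse, [], rows, []⟩
  -- Each unpinned row is stored as `U.length` bits and one mask.
  have hlen : rows.length = U.length * (U.length + 1) := by
    simp [hR, List.length_flatMap]
  let q1 := g.ws.flatMap fun w => ((U.map μ).reverse.map (g.nbr w)).reverse ++ g.ws.map (g.adj w)
  let q2 := rows.reverse.flatMap g.symbolBits ++ q1
  let q3 := ((U.map μ).reverse.map fun _ => true).reverse ++ (false :: q2)
  have e1 : Exec O (g.pushGadgetRows g.ws) (st []) (st q1) _ :=
    (g.exec_pushGadgetRows g.ws (st []) rfl rfl).of_eq rfl (by simp [st, q1]) le_rfl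
  have e2 : Exec O g.pushRows (st q1) (st q2) _ := g.exec_pushRows (st q1) rfl rfl
  have e3 : Exec O (.push (.inl .query) always fun _ => false) (st q2) (st (false :: q2)) 1 :=
    .push_eq rfl
  have e4 : Exec O (pushMasks fun _ => true) (st (false :: q2)) (st q3) _ :=
    exec_pushMasks (fun _ => true) (st (false :: q2)) rfl rfl
  have e5 : Exec O (pushAll always (g.ws.map fun _ _ => true)) (st q3)
      (st (g.attachCode U a μ)) (g.ws.length + 1) := by
    refine (exec_pushAll always (g.ws.map fun _ _ => true) (st q3)).of_eq rfl ?_ (by simp)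
    simp only [st, Store.mk.injEq, and_true, true_and, attachCode]
    have hq2 : q2 = (U.flatMap fun i => U.map (a i) ++ g.ws.map fun w => g.nbr w (μ i)) ++ q1 := by
      simp only [q2, hR, flatMap_symbolBits]
    simp [always, q3, hq2, q1, unaryCode, Function.comp_def, Nat.add_comm U.length]
    simp [← List.replicate_append_replicate]
  have e6 := (Exec.oracle (O := O) (st (g.attachCode U a μ)))
  rw [show (st (g.attachCode U a μ)).qry = g.attachCode U a μ from rfl, hv] at e6
  refine Exec.of_eq (e1.seq (e2.seq (e3.seq (e4.seq (e5.seq (e6.seq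
    ((Exec.load_eq rfl).seq (exec_addAnswer v _ rfl rfl)))))))) rfl rfl ?_
  simp only [st, List.length_reverse, List.length_map, hlen]
  linarith

end Gadget

/-- Processes a list of gadgets. -/
def askAll : List (Gadget h) → RProg h p
  | [] => skip
  | g :: gs => .seq g.ask (askAll gs)

/-- Each summand has degree at most 2 in `L`, so it is at most a constant times `(N + 1) ^ 2`. -/
theorem Gadget.ask_time_le (w L N p : ℕ) (hL : L ≤ N) :
    w * (w + L * 7 + 4) + L * (L + 1) * (w + 8) + L * 7 + p * 2 + 11 ≤
      (w * w + w * 12 + p * 2 + 26) * (N + 1) ^ 2 := by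
  have h1 : 1 ≤ (N + 1) ^ 2 := Nat.one_le_pow _ _ (by omega)
  have h2 : L ≤ (N + 1) ^ 2 := by nlinarith
  have h3 : L * (L + 1) ≤ (N + 1) ^ 2 := by nlinarith
  generalize (N + 1) ^ 2 = M at h1 h2 h3
  calc _ ≤ w * (w * M + M * 7 + 4 * M) + M * (w + 8) + M * 7 + p * M * 2 + 11 * M := by
        gcongr
        · exact Nat.le_mul_of_pos_right _ h1
        · omega
        · exact Nat.le_mul_of_pos_right _ h1
        · omega
    _ = _ := by ring

theorem exec_askAll {ι : Type*} (gs : List (Gadget h)) (v : Gadget h → ℕ) (s : Store h p) (U : List ι)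
    (a : ι → ι → Bool) (μ : ι → Mask h) {ok : Bool} {acc : ZMod p} (hmem : s.mem = .clean ok acc)
    (hM : s.masks = (U.map μ).reverse) (hM' : s.masks' = []) (hR' : s.rows' = [])
    (hR : s.rows = U.reverse.flatMap fun i =>
          (.inr (μ i) : Bool ⊕ Mask h) :: U.reverse.map (fun j => .inl (a i j)))
    (hq : s.qry = []) (hans : s.ans = []) (hv : ∀ g ∈ gs, O (g.attachCode U a μ) = Nat.bits (v g))
    (hp : ∀ g ∈ gs, v g < p) {N : ℕ} (hN : U.length ≤ N) :
    Exec O (askAll gs) s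
      { s with mem := .clean ok (acc + (gs.map fun g => (g.coef * v g : ZMod p)).sum) }
      (1 + (gs.map fun g => g.ws.length * g.ws.length + g.ws.length * 12 + p * 2 + 26).sum *
        (N + 1) ^ 2) := by
  induction gs generalizing s acc with
  | nil => exact (exec_skip s).of_eq rfl (by simp [← hmem]) (by simp)
  | cons g gs ih =>
    -- From `v g < p < 2 ^ p`; the crude bound `p` is a constant.
    have hsize : (v g).size ≤ p := Nat.size_le.2 ((hp g (by simp)).trans Nat.lt_two_pow_self)
    have h1 := g.exec_ask s U a μ hmem hM hM' hR' hR hq hans (hv g (by simp))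
    have h2 := ih { s with mem := .clean ok (acc + g.coef * v g) } rfl hM hM' hR' hR hq hans
      (fun g hg => hv g (by simp [hg])) (fun g hg => hp g (by simp [hg]))
    refine (h1.seq h2).of_eq rfl (by simp [add_assoc]) ?_
    have h3 := Gadget.ask_time_le g.ws.length U.length N p hN
    simp only [List.map_cons, List.sum_cons, add_mul _ _ ((N + 1) ^ 2)] at h3 ⊢
    omega

/-! ### Output and the whole program -/

/-- Writes the first `i` bits of a word of constant length on the output tape. -/
def writeBits (f : Mem h p → List Bool) : ℕ → RProg h p
  | 0 => skip
  | i + 1 => .seq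
    (.push (.inl .output) (fun m => decide (i < (f m).length)) fun m => (f m).getD i false)
    (writeBits f i)

/-- Bits are written from the highest index down, and indices beyond the length write nothing; thus
a fixed number of instructions serves words of varying length. -/
theorem exec_writeBits (f : Mem h p → List Bool) (i : ℕ) (s : Store h p)
    (hout : s.out = (f s.mem).drop i) :
    Exec O (writeBits f i) s { s with out := f s.mem } (i + 1) := by
  induction i generalizing s with
  | zero => exact (exec_skip s).of_eq rfl (by simp at hout; simp [← hout]) le_rfl
  | succ i ih =>
    refine Exec.of_eq (Exec.seq (.push_eq rfl) (ih { s with out := (f s.mem).drop i } rfl |>.of_eq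
      ?_ rfl le_rfl)) rfl rfl (by omega)
    by_cases hi : i < (f s.mem).length
    · simp [hi, Store.set, Store.stk, hout]
    · have h1 : (f s.mem).drop (i + 1) = [] := List.drop_eq_nil_of_le (by omega)
      have h2 : (f s.mem).drop i = [] := List.drop_eq_nil_of_le (by omega)
      simp [hi, h2, ← h1, ← hout]

/-- Reads a graph with labels, queries the oracle for the graphs obtained by attaching the gadgets
`gs`, and writes the result `f m`, where `m` is the final content of the memory. -/
def solve (compat : Fin (h + 1) → Fin (h + 1) → Bool) (gs : List (Gadget h))
    (f : Mem h p → List Bool) (B : ℕ) : RProg h p :=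
  .seq readSize (.seq readLabels (.seq copyLabels (.seq (readRows compat)
    (.seq (askAll gs) (writeBits f B)))))

theorem exec_solve {ι : Type*} (compat : Fin (h + 1) → Fin (h + 1) → Bool) (gs : List (Gadget h))
    (f : Mem h p → List Bool) (B : ℕ) (js : List ι) (lab : ι → Fin (h + 1)) (a : ι → ι → Bool)
    (μ : ι → Mask h) (hμ : ∀ i l, μ i l = js.any fun j => a i j && l == lab j) (v : Gadget h → ℕ)
    (hv : ∀ g ∈ gs, O (g.attachCode (js.filter (lab · == 0)) a μ) = Nat.bits (v g))
    (hp : ∀ g ∈ gs, v g < p) (hf : ∀ m, (f m).length ≤ B) :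
    ∃ s' : Store h p, Exec O (solve compat gs f B)
      ⟨.clean true 0, unaryCode js.length ++ ((js.flatMap fun j => unaryCode (lab j)) ++
        js.flatMap fun i => js.map (a i)), [], [], [], [], [], [], [], [], [], [], []⟩ s'
      ((20 + h * 2 + B +
        (gs.map fun g => g.ws.length * g.ws.length + g.ws.length * 12 + p * 2 + 26).sum) *
        (js.length + 1) ^ 2) ∧
      s'.out = f (.clean (js.all fun i => decide (∀ l, μ i l → compat (lab i) l))
        (gs.map fun g => (g.coef * v g : ZMod p)).sum) := by
  let acc : ZMod p := (gs.map fun g => (g.coef * v g : ZMod p)).sum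
  let ok := js.all fun i => decide (∀ l, μ i l → compat (lab i) l)
  let adj := js.flatMap fun i => js.map (a i)
  let M := ((js.filter (lab · == 0)).map μ).reverse
  let R := (js.filter (lab · == 0)).reverse.flatMap fun i =>
    (.inr (μ i) : Bool ⊕ Mask h) :: (js.filter (lab · == 0)).reverse.map (fun j => .inl (a i j))
  have e1 := exec_readSize (O := O) (p := p) (h := h) ⟨.clean true 0, unaryCode js.length ++
    ((js.flatMap fun j => unaryCode (lab j)) ++ adj), [], [], [], [], [], [], [], [], [], [], []⟩ rfl rfl
  have e2 := exec_readLabels (O := O) (p := p) ⟨.clean true 0,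
    (js.flatMap fun j => unaryCode (lab j)) ++ adj, [], [], [],
    List.replicate js.length true, [], [], [], [], [], [], []⟩ js lab rfl rfl rfl rfl
  have e3 := exec_copyLabels (O := O) (p := p) ⟨.clean true 0, adj, [], [], [], [], [],
    (js.map lab).reverse, [], [], [], [], []⟩ rfl rfl rfl
  have e4 := exec_readRows (O := O) (p := p) compat ⟨.clean true 0, adj, [], [], [], [],
    (js.map lab), [], js.map lab, [], [], [], []⟩ js js lab a μ hμ (r := []) rfl (by simp [adj])
    rfl rfl rfl rfl rfl
  have e5 := exec_askAll (O := O) (p := p) gs v ⟨.clean ok 0, [], [], [], [], [],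
    js.map lab, [], [], M, [], R, []⟩ (js.filter (lab · == 0)) a μ rfl rfl rfl rfl rfl rfl rfl hv hp
    (List.length_filter_le _ _)
  have e6 := exec_writeBits (O := O) (p := p) (h := h) f B ⟨.clean ok (0 + acc), [], [], [], [], [],
    js.map lab, [], [], M, [], R, []⟩ (by simp [hf])
  refine ⟨_, (e1.seq (e2.seq ((e3.of_eq rfl ?_ le_rfl).seq (e4.seq (e5.seq e6))))).weaken ?_, ?_⟩
  · simp
  · simp only [List.length_reverse, List.length_map]
    generalize (gs.map fun g => g.ws.length * g.ws.length + g.ws.length * 12 + p * 2 + 26).sum = S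
    have h1 : 1 ≤ (js.length + 1) ^ 2 := Nat.one_le_pow _ _ (by omega)
    have h2 : js.length ≤ (js.length + 1) ^ 2 := by nlinarith
    have h3 : js.length * (h * 2) ≤ (h * 2) * (js.length + 1) ^ 2 := by nlinarith
    have h4 : B ≤ B * (js.length + 1) ^ 2 := Nat.le_mul_of_pos_right _ h1
    nlinarith
  · simp [acc, ok]

/-- The program `solve` computes what it should in polynomial time. -/
theorem solve_outputsWithin [NeZero p] (compat : Fin (h + 1) → Fin (h + 1) → Bool)
    (gs : List (Gadget h)) (f : Mem h p → List Bool) (B : ℕ) (hf : ∀ m, (f m).length ≤ B) :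
    ∃ time : Polynomial ℕ, ∀ (O : List Bool → List Bool) (n : ℕ) (lab : Fin n → Fin (h + 1))
      (a : Fin n → Fin n → Bool) (μ : Fin n → Mask h)
      (_ : ∀ i l, μ i l = (List.finRange n).any fun j => a i j && l == lab j) (v : Gadget h → ℕ)
      (_ : ∀ g ∈ gs, O (g.attachCode ((List.finRange n).filter (lab · == 0)) a μ) = Nat.bits (v g))
      (_ : ∀ g ∈ gs, v g < p) (x : List Bool)
      (_ : x = unaryCode n ++ (((List.finRange n).flatMap fun j => unaryCode (lab j)) ++
        (List.finRange n).flatMap fun i => (List.finRange n).map (a i))),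
      (machine (solve compat gs f B) (.clean true 0)).OutputsWithin O x
        (f (.clean ((List.finRange n).all fun i => decide (∀ l, μ i l → compat (lab i) l))
          (gs.map fun g => (g.coef * v g : ZMod p)).sum)) (time.eval x.length) := by
  let C := 20 + h * 2 + B +
    (gs.map fun g => g.ws.length * g.ws.length + g.ws.length * 12 + p * 2 + 26).sum
  -- `n` is at most the input length because the size is coded in unary; the final `+ 1` pays for
  -- halting.
  refine ⟨Polynomial.C C * (Polynomial.X + 1) ^ 2 + 1, ?_⟩
  intro O n lab a μ hμ v hv hp x hx
  obtain ⟨s', he, hs'⟩ := exec_solve (O := O) compat gs f B (List.finRange n) lab a μ hμ v hv hp hf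
  rw [List.length_finRange, ← hx] at he
  rw [← hs']
  have h1 : C * (n + 1) ^ 2 + 1 ≤
      (Polynomial.C C * (Polynomial.X + 1) ^ 2 + 1 : Polynomial ℕ).eval x.length := by
    have h2 : n ≤ x.length := by
      simp only [hx, unaryCode, List.length_append, List.length_replicate]
      omega
    simp only [Polynomial.eval_add, Polynomial.eval_mul, Polynomial.eval_C, Polynomial.eval_pow,
      Polynomial.eval_X, Polynomial.eval_one]
    gcongr
  have h3 : Store.stk (p := p) (h := h) ⟨.clean true 0, x, [], [], [], [], [], [], [], [], [], [], []⟩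
      = Function.update (β := fun k => List (TapeAlphabet (WorkAlphabet h) k)) (fun _ => [])
        (.inl .input) x := by
    funext k
    rcases k with (_ | _) | (_ | _) <;> rfl
  unfold Exec at he
  rw [h3] at he
  obtain ⟨h4, h5⟩ := he.outputsWithin
  exact outputsWithin_of_halted h1 h4 h5

end StackProgram

/-! ### Inclusion-exclusion over quotients of `H` -/

namespace PinnedHoms

open Finset

section Glue

variable {V X : Type} (H : SimpleGraph V) (G : SimpleGraph X) (pin : X → Option V)

/-- The graph obtained from the unpinned part of `G` and the quotient `H / r` by joining an unpinned
vertex to the classes of the labels of its pinned neighbours. -/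
def glue (r : Setoid V) (hr : ∀ a b, r a b → ¬H.Adj a b) :
    SimpleGraph ({x // pin x = none} ⊕ Quotient r) where
  Adj
    | .inl x, .inl x' => G.Adj x x'
    | .inl x, .inr q => ∃ c, ⟦c⟧ = q ∧ ∃ u, G.Adj x u ∧ pin u = some c
    | .inr q, .inl x => ∃ c, ⟦c⟧ = q ∧ ∃ u, G.Adj x u ∧ pin u = some c
    | .inr q, .inr q' => ∃ a b, ⟦a⟧ = q ∧ ⟦b⟧ = q' ∧ H.Adj a b
  symm := ⟨by
    rintro (x | q) (x' | q') h
    · exact h.symm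
    · exact h
    · exact h
    · obtain ⟨a, b, ha, hb, hab⟩ := h
      exact ⟨b, a, hb, ha, hab.symm⟩⟩
  loopless := ⟨by
    rintro (x | q) h
    · exact G.loopless.irrefl _ h
    · obtain ⟨a, b, ha, hb, hab⟩ := h
      exact hr a b (Quotient.exact (ha.trans hb.symm)) hab⟩

/-- `y` is an endomorphism of `H`, and `f` a homomorphism from the unpinned part of `G` to `H`, where
the label `w` now stands for the vertex `y w`. -/
def IsPair (q : (V → V) × ({x // pin x = none} → V)) : Prop :=
  (∀ a b, H.Adj a b → H.Adj (q.1 a) (q.1 b)) ∧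
    (∀ x x' : {x // pin x = none}, G.Adj x x' → H.Adj (q.2 x) (q.2 x')) ∧
    ∀ (x : {x // pin x = none}) u w, G.Adj x u → pin u = some w → H.Adj (q.2 x) (q.1 w)

/-- Homomorphisms from the glued graph as pairs of maps. -/
def glueHomEquiv (r : Setoid V) (hr : ∀ a b, r a b → ¬H.Adj a b) :
    (glue H G pin r hr →g H) ≃ {q // IsPair H G pin q ∧ ∀ a b, r a b → q.1 a = q.1 b} where
  toFun g := ⟨(fun a => g (.inr ⟦a⟧), fun x => g (.inl x)),
    ⟨fun a b hab => g.map_rel (show (glue H G pin r hr).Adj (.inr ⟦a⟧) (.inr ⟦b⟧) from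
        ⟨a, b, rfl, rfl, hab⟩),
      fun x x' hx => g.map_rel (show (glue H G pin r hr).Adj (.inl x) (.inl x') from hx),
      fun x u w hu hw => g.map_rel (show (glue H G pin r hr).Adj (.inl x) (.inr ⟦w⟧) from
        ⟨w, rfl, u, hu, hw⟩)⟩,
    fun a b hab => congrArg (fun q => g (.inr q)) (Quotient.sound hab)⟩
  invFun q := ⟨Sum.elim q.1.2 (Quotient.lift q.1.1 q.2.2), by
    obtain ⟨⟨y, f⟩, ⟨h1, h2, h3⟩, h4⟩ := q
    rintro (x | c) (x' | c') h
    · exact h2 x x' h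
    · obtain ⟨c, rfl, u, hu, hc⟩ := h
      exact h3 x u c hu hc
    · obtain ⟨c, rfl, u, hu, hc⟩ := h
      exact (h3 x' u c hu hc).symm
    · obtain ⟨a, b, rfl, rfl, hab⟩ := h
      exact h1 a b hab⟩
  left_inv g := by
    ext (x | c)
    · rfl
    · induction c using Quotient.inductionOn
      rfl
  right_inv q := rfl

end Glue

/-- The equivalence relation generated by `E`. -/
def generated {V : Type} (E : Finset (V × V)) : Setoid V := Relation.EqvGen.setoid fun a b => (a, b) ∈ E

/-- The kernel of `y` is an equivalence relation, so generators suffice. -/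
theorem generated_le_iff {V : Type} (E : Finset (V × V)) (y : V → V) :
    (∀ a b, generated E a b → y a = y b) ↔ ∀ e ∈ E, y e.1 = y e.2 := by
  constructor
  · intro h e he
    exact h _ _ (Relation.EqvGen.rel _ _ he)
  · intro h a b hab
    induction hab with
    | rel a b hab => exact h _ hab
    | refl => rfl
    | symm _ _ _ ih => exact ih.symm
    | trans _ _ _ _ _ ih ih' => exact ih.trans ih'

/-- An injective endomorphism of a finite graph is an automorphism. -/
theorem exists_iso_of_injective {V : Type} [Finite V] (H : SimpleGraph V) (y : V → V) (hy : Function.Injective y)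
    (hH : ∀ a b, H.Adj a b → H.Adj (y a) (y b)) : ∃ φ : H ≃g H, ⇑φ = y := by
  have hb : Function.Bijective y := Finite.injective_iff_bijective.1 hy
  -- The induced map on the finite set of darts is injective, hence surjective; so `y` also reflects
  -- adjacency.
  let F : {e : V × V // H.Adj e.1 e.2} → {e : V × V // H.Adj e.1 e.2} :=
    fun e => ⟨(y e.1.1, y e.1.2), hH _ _ e.2⟩
  have hF : Function.Surjective F := Finite.injective_iff_surjective.1 (by
    rintro ⟨⟨a, b⟩, hab⟩ ⟨⟨a', b'⟩, hab'⟩ h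
    simp only [F, Subtype.mk.injEq, Prod.mk.injEq] at h ⊢
    exact ⟨hy h.1, hy h.2⟩)
  refine ⟨⟨Equiv.ofBijective y hb, ?_⟩, rfl⟩
  intro a b
  refine ⟨fun h => ?_, hH a b⟩
  obtain ⟨⟨⟨a', b'⟩, hab⟩, he⟩ := hF ⟨(y a, y b), h⟩
  have he' : (y a', y b') = (y a, y b) := congrArg Subtype.val he
  rw [Prod.mk.injEq] at he'
  rwa [← hy he'.1, ← hy he'.2]

/-- The bijection is `(φ, f) ↦ (φ, φ ∘ f)`, inverted by applying `φ⁻¹` to the second map. -/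
theorem card_isPair_injective {V X : Type} [Finite V] (H : SimpleGraph V) (G : SimpleGraph X)
    (pin : X → Option V) :
    Nat.card {q // IsPair H G pin q ∧ Function.Injective q.1} =
      Nat.card (H ≃g H) * Nat.card {f // IsPair H G pin (id, f)} := by
  rw [← Nat.card_prod]
  refine (Nat.card_congr (Equiv.ofBijective
    (fun z : (H ≃g H) × {f // IsPair H G pin (id, f)} =>
      (⟨(z.1, fun x => z.1 (z.2.1 x)), ?_⟩ : {q // IsPair H G pin q ∧ Function.Injective q.1}))
      ⟨?_, ?_⟩)).symm
  · obtain ⟨φ, f, h1, h2, h3⟩ := z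
    exact ⟨⟨fun a b => φ.map_rel_iff.2, fun x x' h => φ.map_rel_iff.2 (h2 x x' h),
      fun x u w hu hw => φ.map_rel_iff.2 (h3 x u w hu hw)⟩, φ.injective⟩
  · rintro ⟨φ, f, hf⟩ ⟨φ', f', hf'⟩ h
    simp only [Subtype.mk.injEq, Prod.mk.injEq] at h
    have h1 : φ = φ' := DFunLike.coe_injective h.1
    subst h1
    simp only [Prod.mk.injEq, Subtype.mk.injEq, true_and]
    funext x
    exact φ.injective (congrFun h.2 x)
  · rintro ⟨⟨y, f⟩, ⟨h1, h2, h3⟩, hy⟩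
    obtain ⟨φ, rfl⟩ := exists_iso_of_injective H y hy h1
    refine ⟨(φ, ⟨fun x => φ.symm (f x), fun _ _ h => h, fun x x' h => ?_, fun x u w hu hw => ?_⟩), ?_⟩
    · exact φ.symm.map_rel_iff.2 (h2 x x' h)
    · have := φ.symm.map_rel_iff.2 (h3 x u w hu hw)
      simpa using this
    · simp

section InclusionExclusion

variable {V X : Type} [Fintype V] [DecidableEq V]

/-- The sets `E` that `y` collapses are the subsets of its off-diagonal kernel. Their alternating
sum vanishes unless that kernel is empty, that is, unless `y` is injective. -/
theorem sum_powerset_collapsed (y : V → V) :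
    (∑ E ∈ (univ : Finset V).offDiag.powerset,
      if ∀ e ∈ E, y e.1 = y e.2 then (-1 : ℤ) ^ #E else 0) =
        if Function.Injective y then 1 else 0 := by
  rw [← sum_filter]
  have h1 : (univ : Finset V).offDiag.powerset.filter (fun E => ∀ e ∈ E, y e.1 = y e.2) =
      ((univ : Finset V).offDiag.filter fun e => y e.1 = y e.2).powerset := by
    ext E
    simp only [mem_filter, mem_powerset, subset_iff]
    grind
  rw [h1, sum_powerset_neg_one_pow_card]
  congr 1
  rw [eq_iff_iff, filter_eq_empty_iff]
  constructor
  · intro h a b hab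
    by_contra hne
    exact h (x := (a, b)) (by simpa using hne) hab
  · intro h e he hy
    exact (mem_offDiag.1 he).2.2 (h hy)

variable (H : SimpleGraph V) (G : SimpleGraph X) (pin : X → Option V)

/-- Write each count as a sum over pairs `q` and exchange the sums. The function `c` stands in for
the counts because `glue` exists only when the quotient has no loop. -/
theorem sum_card_glue [Finite X] (c : Finset (V × V) → ℕ)
    (hc : ∀ E (hE : ∀ a b, generated E a b → ¬H.Adj a b),
      c E = Nat.card (glue H G pin (generated E) hE →g H))
    (hc' : ∀ E, (¬∀ a b, generated E a b → ¬H.Adj a b) → c E = 0) :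
    ∑ E ∈ (univ : Finset V).offDiag.powerset, (-1 : ℤ) ^ #E * c E =
      Nat.card (H ≃g H) * Nat.card {f // IsPair H G pin (id, f)} := by
  classical
  have := Fintype.ofFinite X
  have h1 : ∀ E, (c E : ℤ) = ∑ q : {q // IsPair H G pin q},
      if ∀ e ∈ E, q.1.1 e.1 = q.1.1 e.2 then 1 else 0 := by
    intro E
    rw [sum_boole, Nat.cast_inj, ← Fintype.card_subtype, ← Nat.card_eq_fintype_card]
    by_cases hE : ∀ a b, generated E a b → ¬H.Adj a b
    · rw [hc E hE, Nat.card_congr (glueHomEquiv H G pin _ hE)]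
      refine Nat.card_congr (Equiv.trans ?_ (Equiv.subtypeSubtypeEquivSubtypeInter _
        fun q : (V → V) × ({x // pin x = none} → V) => ∀ e ∈ E, q.1 e.1 = q.1 e.2).symm)
      exact Equiv.subtypeEquivRight fun q => by rw [generated_le_iff]
    · rw [hc' E hE]
      symm
      rw [Nat.card_eq_zero]
      left
      -- A pair that collapses `E` would send an edge inside a class to a loop of `H`.
      refine ⟨fun q => hE fun a b hab hadj => ?_⟩
      obtain ⟨⟨q, hq⟩, hE'⟩ := q
      have := hq.1 a b hadj
      rw [(generated_le_iff E q.1).2 hE' a b hab] at this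
      exact H.loopless.irrefl _ this
  simp_rw [h1, mul_sum]
  rw [sum_comm]
  simp_rw [mul_ite, mul_one, mul_zero, sum_powerset_collapsed]
  rw [sum_boole, ← Fintype.card_subtype, ← Nat.card_eq_fintype_card, ← Nat.cast_mul, Nat.cast_inj,
    ← card_isPair_injective]
  exact Nat.card_congr (Equiv.subtypeSubtypeEquivSubtypeInter _
    fun q : (V → V) × ({x // pin x = none} → V) => Function.Injective q.1)

end InclusionExclusion

/-! ### Labelled homomorphisms and encodings of glued graphs -/

section Homs

variable {V : Type} (H : SimpleGraph V) (J : PartLabGraph V)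

/-- Homomorphisms from a partially labelled graph as maps on the unpinned vertices. -/
theorem ncard_homs (hJ : ∀ i u w w', J.graph.Adj i u → J.pin i = some w → J.pin u = some w' →
    H.Adj w w') : (J.Homs H).ncard = Nat.card {f // IsPair H J.graph J.pin (id, f)} := by
  rw [← Nat.card_coe_set_eq]
  refine Nat.card_congr (Equiv.ofBijective (fun σ => ⟨fun x => σ.1 x, fun _ _ h => h,
    fun x x' h => σ.1.map_rel h, fun x u w hu hw => ?_⟩) ⟨?_, ?_⟩)
  · have := σ.1.map_rel hu
    rwa [σ.2 u w hw] at this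
  · rintro ⟨σ, hσ⟩ ⟨σ', hσ'⟩ h
    refine Subtype.ext (DFunLike.ext _ _ fun x => ?_)
    rcases hx : J.pin x with _ | w
    · exact congrFun (congrArg Subtype.val h) ⟨x, hx⟩
    · exact (hσ x w hx).trans (hσ' x w hx).symm
  · rintro ⟨f, -, h2, h3⟩
    let σ : Fin J.n → V := fun x => if hx : J.pin x = none then f ⟨x, hx⟩ else
      (J.pin x).get (Option.isSome_iff_ne_none.2 hx)
    have h4 : ∀ x (hx : J.pin x = none), σ x = f ⟨x, hx⟩ := fun x hx => dif_pos hx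
    have h5 : ∀ x w, J.pin x = some w → σ x = w := by
      intro x w hx
      simp [σ, hx]
    refine ⟨⟨⟨σ, ?_⟩, h5⟩, ?_⟩
    · intro x x' hxx
      rcases hx : J.pin x with _ | w <;> rcases hx' : J.pin x' with _ | w'
      · rw [h4 x hx, h4 x' hx']
        exact h2 ⟨x, hx⟩ ⟨x', hx'⟩ hxx
      · rw [h4 x hx, h5 x' w' hx']
        exact h3 ⟨x, hx⟩ x' w' hxx hx'
      · rw [h5 x w hx, h4 x' hx']
        exact (h3 ⟨x', hx'⟩ x w hxx.symm hx).symm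
      · rw [h5 x w hx, h5 x' w' hx']
        exact hJ x x' w w' hxx hx hx'
    · exact Subtype.ext (funext fun x => h4 x x.2)

theorem ncard_homs_eq_zero (hJ : ¬∀ i u w w', J.graph.Adj i u → J.pin i = some w →
    J.pin u = some w' → H.Adj w w') : (J.Homs H).ncard = 0 := by
  have : J.Homs H = ∅ := by
    rw [Set.eq_empty_iff_forall_notMem]
    intro σ hσ
    refine hJ fun i u w w' hiu hi hu => ?_
    have := σ.map_rel hiu
    rwa [hσ i w hi, hσ u w' hu] at this
  simp [this]

end Homs

end PinnedHoms

/-- A list of all vertices of a graph yields an input graph that is isomorphic to it. -/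
theorem FinGraph.exists_of_list {W V : Type} (H : SimpleGraph V) (G : SimpleGraph W) (l : List W)
    (hl : l.Nodup) (hl' : ∀ w, w ∈ l) (a : W → W → Bool) (ha : ∀ w w', a w w' = true ↔ G.Adj w w') :
    ∃ F : FinGraph, F.encode = unaryCode l.length ++ (l.flatMap fun w => l.map (a w)) ∧
      Nat.card (F.graph →g H) = Nat.card (G →g H) := by
  classical
  let e : Fin l.length ≃ W := hl.getEquivOfForallMemList l hl'
  let F : FinGraph := ⟨l.length, G.comap e⟩
  have he : l = (List.finRange l.length).map e := by
    symm
    exact List.map_get_finRange l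
  refine ⟨F, ?_, Nat.card_congr ?_⟩
  · have h1 : (l.flatMap fun w => l.map (a w)) = adjBits F.graph := by
      -- Stated for a fresh list, since `l` also occurs inside `e` and `F`.
      have h2 : ∀ l', l' = (List.finRange l.length).map e →
          (l'.flatMap fun w => l'.map (a w)) = adjBits F.graph := by
        rintro _ rfl
        simp only [adjBits, List.flatMap_map, List.map_map]
        refine List.flatMap_congr fun i _ => List.map_congr_left fun j _ => ?_
        rw [Bool.eq_iff_iff, Function.comp_apply, ha, decide_eq_true_eq]
        rfl
      exact h2 l he
    rw [h1]
    rfl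
  · let φ : F.graph ≃g G := ⟨e, Iff.rfl⟩
    exact ⟨fun f => f.comp φ.symm.toHom, fun f => f.comp φ.toHom,
      fun f => by ext x; simp, fun f => by ext x; simp⟩

/-! ### The reduction for labels in `Fin h` -/

namespace PinReduction

open StackProgram PinnedHoms

variable {h : ℕ}

/-- The code of a label, `0` for an unpinned vertex. -/
def labelCode : Option (Fin h) → Fin (h + 1) := fun o => o.elim 0 Fin.succ

theorem labelCode_injective : Function.Injective (labelCode (h := h)) := by
  rintro (_ | a) (_ | b) hab
  · rfl
  · exact absurd hab.symm (Fin.succ_ne_zero b)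
  · exact absurd hab (Fin.succ_ne_zero a)
  · exact congrArg some (Fin.succ_injective _ hab)

theorem val_labelCode (o : Option (Fin h)) : (labelCode o : ℕ) = labelIndex (Equiv.refl _) o := by
  cases o <;> rfl

variable (H : SimpleGraph (Fin h))

open scoped Classical in
/-- Two adjacent vertices may have the labels with these codes. -/
noncomputable def compat (a b : Fin (h + 1)) : Bool :=
  decide (∀ w w' : Fin h, a = w.succ → b = w'.succ → H.Adj w w')

open scoped Classical in
/-- The quotient of `H` by the equivalence relation generated by `E`, as a gadget. -/
noncomputable def quotientGadget (E : Finset (Fin h × Fin h)) : Gadget h where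
  W := Quotient (generated E)
  ws := Finset.univ.toList
  nbr q μ := decide (∃ c : Fin h, ⟦c⟧ = q ∧ μ c.succ)
  adj q q' := decide (∃ a b, ⟦a⟧ = q ∧ ⟦b⟧ = q' ∧ H.Adj a b)
  coef := (-1) ^ E.card

open scoped Classical in
-- Listing the unpinned vertices before the classes of the quotient makes the adjacency matrix of
-- the glued graph the query word. Masks may also contain the code 0 of unpinned neighbours, which
-- `nbr` never inspects.
theorem exists_attachCode_eq (J : PartLabGraph (Fin h)) (E : Finset (Fin h × Fin h))
    (hE : ∀ a b, generated E a b → ¬H.Adj a b) (μ : Fin J.n → Mask h)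
    (hμ : ∀ i l, μ i l = (List.finRange J.n).any fun j =>
      decide (J.graph.Adj i j) && l == labelCode (J.pin j)) :
    ∃ F : FinGraph, F.encode = (quotientGadget H E).attachCode
        ((List.finRange J.n).filter fun i => labelCode (J.pin i) == 0)
        (fun i j => decide (J.graph.Adj i j)) μ ∧
      Nat.card (F.graph →g H) = Nat.card (glue H J.graph J.pin (generated E) hE →g H) := by
  have hzero : ∀ i, (labelCode (J.pin i) == 0) = true ↔ J.pin i = none := by
    intro i
    rw [beq_iff_eq]
    exact labelCode_injective.eq_iff (b := none)
  generalize hf : ((List.finRange J.n).filter fun i => labelCode (J.pin i) == 0) = L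
  have hL : ∀ i ∈ L, J.pin i = none := by
    intro i hi
    rw [← hf, List.mem_filter] at hi
    exact (hzero i).1 hi.2
  -- The unpinned vertices are lifted to the subtype that forms the vertices of `glue`.
  obtain ⟨U, rfl, hU, hU'⟩ : ∃ U : List {x // J.pin x = none}, U.map Subtype.val = L ∧ U.Nodup ∧
      ∀ x, x ∈ U := by
    have h1 : (L.attachWith _ hL).map Subtype.val = L := List.attachWith_map_subtype_val hL
    refine ⟨L.attachWith _ hL, h1, List.Nodup.of_map Subtype.val ?_, fun x => ?_⟩
    · rw [h1, ← hf]
      exact (List.nodup_finRange _).filter _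
    · rw [List.mem_attachWith, ← hf, List.mem_filter]
      exact ⟨List.mem_finRange _, (hzero _).2 x.2⟩
  have hnbr : ∀ (x : {x // J.pin x = none}) q, (quotientGadget H E).nbr q (μ x) = true ↔
      ∃ c, ⟦c⟧ = q ∧ ∃ u, J.graph.Adj x u ∧ J.pin u = some c := by
    intro x q
    simp only [quotientGadget, decide_eq_true_eq]
    refine exists_congr fun c => and_congr_right fun _ => ?_
    simp only [hμ, List.any_eq_true, List.mem_finRange, true_and, Bool.and_eq_true,
      decide_eq_true_eq, beq_iff_eq]
    refine exists_congr fun u => and_congr_right fun _ => ?_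
    rw [eq_comm]
    exact labelCode_injective.eq_iff (b := some c)
  let ws : List (Quotient (generated E)) := Finset.univ.toList
  obtain ⟨F, hF, hF'⟩ := FinGraph.exists_of_list H (glue H J.graph J.pin (generated E) hE)
    (U.map Sum.inl ++ ws.map Sum.inr)
    (List.Nodup.append (hU.map Sum.inl_injective) ((Finset.nodup_toList _).map Sum.inr_injective)
      (by simp [List.disjoint_left]))
    (by rintro (x | q) <;> simp [hU', ws])
    (fun a b => Sum.elim
      (fun x : {x // J.pin x = none} => Sum.elim
        (fun x' : {x // J.pin x = none} => decide (J.graph.Adj x x'))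
        (fun q : Quotient (generated E) => (quotientGadget H E).nbr q (μ x)) b)
      (fun q : Quotient (generated E) => Sum.elim
        (fun x : {x // J.pin x = none} => (quotientGadget H E).nbr q (μ x))
        (fun q' : Quotient (generated E) => (quotientGadget H E).adj q q') b) a) (by
      rintro (x | q) (x' | q')
      · exact decide_eq_true_iff
      · exact hnbr x q'
      · exact hnbr x' q
      · exact decide_eq_true_iff)
  refine ⟨F, ?_, hF'⟩
  rw [hF]
  simp only [Gadget.attachCode, List.flatMap_append, List.map_append, List.flatMap_map,
    List.map_map, List.length_append, List.length_map]
  rfl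

theorem foldr_bit_bits (k : ℕ) : (Nat.bits k).foldr Nat.bit 0 = k := by
  induction k using Nat.binaryRec' with
  | zero => simp
  | bit b k hb ih => rw [Nat.bits_append_bit k b hb, List.foldr_cons, ih]

open scoped Classical in
/-- The gadgets used by the reduction. -/
noncomputable def gadgets : List (Gadget h) :=
  ((Finset.univ : Finset (Fin h)).offDiag.powerset.filter
    fun E => ∀ a b, generated E a b → ¬H.Adj a b).toList.map (quotientGadget H)

/-- The result of the reduction as a function of the final content of the memory. -/
noncomputable def result {p : ℕ} (m : Mem h p) : ℕ :=
  if m.ok then (m.acc * (Nat.card (H ≃g H) : ZMod p)⁻¹).val else 0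

/-- Cauchy's theorem: a prime dividing the order of `Aut H` is the order of some automorphism. -/
theorem card_aut_ne_zero {p : ℕ} (hp : p.Prime) (hH : ∀ φ : H ≃g H, orderOf φ ≠ p) :
    (Nat.card (H ≃g H) : ZMod p) ≠ 0 := by
  rw [Ne, ZMod.natCast_eq_zero_iff]
  intro hdvd
  have := Fact.mk hp
  have : Finite (H ≃g H) := Finite.of_injective _ (DFunLike.coe_injective (F := H ≃g H))
  obtain ⟨φ, hφ⟩ := exists_prime_orderOf_dvd_card' p hdvd
  exact hH φ hφ

open scoped Classical in
-- This is `sum_card_glue` modulo `p`; sets `E` whose quotient has a loop have no gadget and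
-- contribute 0.
theorem sum_gadgets {p : ℕ} (J : PartLabGraph (Fin h)) (v : Gadget h → ℕ)
    (hv : ∀ E (hE : ∀ a b, generated E a b → ¬H.Adj a b), (v (quotientGadget H E) : ZMod p) =
      Nat.card (glue H J.graph J.pin (generated E) hE →g H)) :
    ((gadgets H).map fun g => (g.coef * v g : ZMod p)).sum =
      Nat.card (H ≃g H) * Nat.card {f // IsPair H J.graph J.pin (id, f)} := by
  let c : Finset (Fin h × Fin h) → ℕ := fun E =>
    if hE : ∀ a b, generated E a b → ¬H.Adj a b then
      Nat.card (glue H J.graph J.pin (generated E) hE →g H) else 0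
  have h1 := congrArg (Int.cast (R := ZMod p)) (sum_card_glue H J.graph J.pin c
    (fun E hE => dif_pos hE) (fun E hE => dif_neg hE))
  push_cast at h1
  rw [← h1, gadgets, List.map_map, Finset.sum_map_toList, Finset.sum_filter]
  refine Finset.sum_congr rfl fun E _ => ?_
  by_cases hE : ∀ a b, generated E a b → ¬H.Adj a b
  · rw [if_pos hE]
    simp only [Function.comp_apply, hv E hE, c, dif_pos hE]
    simp [quotientGadget]
  · rw [if_neg hE]
    simp only [c, dif_neg hE]
    simp

open scoped Classical in
theorem reducible_fin (p : ℕ) (hp : p.Prime) (hH : ∀ φ : H ≃g H, orderOf φ ≠ p) :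
    (partLabHomsTo p H (Equiv.refl _)).PolyTimeTuringReducible (homsTo p H) := by
  have := Fact.mk hp
  have hB : ∀ m : Mem h p, (Nat.bits (result H m)).length ≤ p := by
    intro m
    rw [Nat.size_eq_bits_len, Nat.size_le]
    refine lt_trans ?_ Nat.lt_two_pow_self
    unfold result
    split
    · exact ZMod.val_lt _
    · exact hp.pos
  obtain ⟨time, htime⟩ := solve_outputsWithin (compat H) (gadgets H)
    (fun m : Mem h p => Nat.bits (result H m)) p hB
  refine ⟨machine (solve (compat H) (gadgets H) (fun m : Mem h p => Nat.bits (result H m)) p)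
    (.clean true 0), time, fun O hO J => ?_⟩
  let μ : Fin J.n → Mask h := fun i l => (List.finRange J.n).any fun j =>
    decide (J.graph.Adj i j) && l == labelCode (J.pin j)
  -- Decoding the oracle's answer defines `v` on all gadgets, without choosing a set `E` for each.
  let v : Gadget h → ℕ := fun g => (O (g.attachCode
    ((List.finRange J.n).filter fun i => labelCode (J.pin i) == 0)
    (fun i j => decide (J.graph.Adj i j)) μ)).foldr Nat.bit 0
  have hv : ∀ E (hE : ∀ a b, generated E a b → ¬H.Adj a b),
      v (quotientGadget H E) = Nat.card (glue H J.graph J.pin (generated E) hE →g H) % p ∧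
      O ((quotientGadget H E).attachCode
        ((List.finRange J.n).filter fun i => labelCode (J.pin i) == 0)
        (fun i j => decide (J.graph.Adj i j)) μ) = Nat.bits (v (quotientGadget H E)) := by
    intro E hE
    obtain ⟨F, hF, hF'⟩ := exists_attachCode_eq H J E hE μ (fun _ _ => rfl)
    have h1 : O F.encode = Nat.bits (Nat.card (F.graph →g H) % p) := hO F
    rw [hF, hF'] at h1
    have h2 : v (quotientGadget H E) =
        Nat.card (glue H J.graph J.pin (generated E) hE →g H) % p := by
      simp only [v, h1, foldr_bit_bits]
    exact ⟨h2, by rw [h1, h2]⟩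
  have hgadgets : ∀ g ∈ gadgets H, ∃ E, (∀ a b, generated E a b → ¬H.Adj a b) ∧
      quotientGadget H E = g := by
    intro g hg
    simp only [gadgets, List.mem_map, Finset.mem_toList, Finset.mem_filter] at hg
    obtain ⟨E, hE, rfl⟩ := hg
    exact ⟨E, hE.2, rfl⟩
  have key := htime O J.n (fun i => labelCode (J.pin i)) (fun i j => decide (J.graph.Adj i j)) μ
    (fun _ _ => rfl) v
    (fun g hg => by
      obtain ⟨E, hE, rfl⟩ := hgadgets g hg
      exact (hv E hE).2)
    (fun g hg => by
      obtain ⟨E, hE, rfl⟩ := hgadgets g hg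
      rw [(hv E hE).1]
      exact Nat.mod_lt _ hp.pos)
    (J.encode (Equiv.refl _)) (by simp only [PartLabGraph.encode, val_labelCode, adjBits])
  -- The test runs over all rows and labels, but `compat` is vacuous for the code 0, so only edges
  -- between pinned vertices matter.
  have hok : ((List.finRange J.n).all fun i =>
      decide (∀ l, μ i l = true → compat H (labelCode (J.pin i)) l = true)) = true ↔
      ∀ i u w w', J.graph.Adj i u → J.pin i = some w → J.pin u = some w' → H.Adj w w' := by
    simp only [List.all_eq_true, List.mem_finRange, true_imp_iff, decide_eq_true_eq, μ, compat,
      List.any_eq_true, true_and, Bool.and_eq_true, beq_iff_eq]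
    constructor
    · intro hall i u w w' hiu hi hu
      exact hall i (labelCode (J.pin u)) ⟨u, hiu, rfl⟩ w w' (by rw [hi]; rfl) (by rw [hu]; rfl)
    · rintro hall i l ⟨u, hiu, rfl⟩ w w' hi hu
      exact hall i u w w' hiu (labelCode_injective hi) (labelCode_injective hu)
  change OracleTM.OutputsWithin _ O (J.encode (Equiv.refl _)) (Nat.bits ((J.Homs H).ncard % p)) _
  refine Eq.mp (congrArg (fun k => OracleTM.OutputsWithin _ O _ (Nat.bits k) _) ?_) key
  by_cases hJ : ∀ i u w w', J.graph.Adj i u → J.pin i = some w → J.pin u = some w' → H.Adj w w'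
  · rw [ncard_homs H J hJ, hok.2 hJ, sum_gadgets H J v (fun E hE => by
      rw [(hv E hE).1, ZMod.natCast_mod])]
    simp only [result, Mem.clean, if_true]
    rw [mul_comm (Nat.card (H ≃g H) : ZMod p), mul_assoc,
      mul_inv_cancel₀ (card_aut_ne_zero H hp hH), mul_one, ZMod.val_natCast]
  · rw [ncard_homs_eq_zero H J hJ, Bool.eq_false_iff.2 (mt hok.1 hJ)]
    simp [result, Mem.clean]

end PinReduction

/-! ### Transfer to an arbitrary label set -/

theorem theorem1p5 (p : ℕ) (hp : p.Prime) {V : Type*} {h : ℕ} (e : V ≃ Fin h) (H : SimpleGraph V)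
    (hH : ∀ φ : H ≃g H, orderOf φ ≠ p) :
    (partLabHomsTo p H e).PolyTimeTuringReducible (homsTo p H) := by
  let H' : SimpleGraph (Fin h) := H.comap e.symm
  let φ : H' ≃g H := SimpleGraph.Iso.comap e.symm H
  -- Conjugation by `φ` is an injective group homomorphism, so it preserves orders of automorphisms.
  let conj : (H' ≃g H') →* (H ≃g H) :=
    { toFun := fun ψ => φ.symm.trans (ψ.trans φ)
      map_one' := by
        refine DFunLike.ext _ _ fun x => ?_
        exact φ.apply_symm_apply x
      map_mul' := fun ψ ψ' => by
        refine DFunLike.ext _ _ fun x => ?_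
        exact congrArg (fun y => φ (ψ y)) (φ.symm_apply_apply _).symm }
  have hconj : Function.Injective conj := by
    intro ψ ψ' hψ
    refine DFunLike.ext _ _ fun x => φ.injective ?_
    have h1 : φ (ψ (φ.symm (φ x))) = φ (ψ' (φ.symm (φ x))) := DFunLike.congr_fun hψ (φ x)
    rwa [φ.symm_apply_apply] at h1
  obtain ⟨M, time, hM⟩ := PinReduction.reducible_fin H' p hp fun ψ hψ =>
    hH (conj ψ) (by rw [orderOf_injective conj hconj, hψ])
  refine ⟨M, time, fun O hO J => ?_⟩
  have hO' : (homsTo p H').IsOracle O := by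
    intro F
    refine (hO F).trans ?_
    have h1 : Nat.card (F.graph →g H) = Nat.card (F.graph →g H') := Nat.card_congr
      ⟨fun f => φ.symm.toHom.comp f, fun f => φ.toHom.comp f, fun f => by ext x; simp,
        fun f => by ext x; simp⟩
    change Nat.bits (_ % p) = Nat.bits (_ % p)
    rw [h1]
  let J' : PartLabGraph (Fin h) := ⟨J.n, J.graph, fun i => (J.pin i).map e⟩
  -- Renaming labels along `e` does not change the input string, so the same machine works.
  have hcode : J'.encode (Equiv.refl _) = J.encode e := by
    have h1 : ∀ o : Option V, labelIndex (Equiv.refl _) (o.map e) = labelIndex e o := by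
      rintro (_ | w) <;> rfl
    simp only [PartLabGraph.encode, J', h1]
  have hcount : (J'.Homs H').ncard = (J.Homs H).ncard := by
    rw [← Nat.card_coe_set_eq, ← Nat.card_coe_set_eq]
    refine Nat.card_congr ⟨fun f => ⟨φ.toHom.comp f.1, fun x w hw => ?_⟩,
      fun f => ⟨φ.symm.toHom.comp f.1, fun x w hw => ?_⟩, fun f => ?_, fun f => ?_⟩
    · have h1 : f.1 x = e w := f.2 x (e w) (by simp [J', hw])
      change e.symm (f.1 x) = w
      rw [h1, e.symm_apply_apply]
    · obtain ⟨w', hw', rfl⟩ := Option.map_eq_some_iff.1 hw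
      change e (f.1 x) = e w'
      rw [f.2 x w' hw']
    · exact Subtype.ext (DFunLike.ext _ _ fun x => φ.symm_apply_apply _)
    · exact Subtype.ext (DFunLike.ext _ _ fun x => φ.apply_symm_apply _)
  have h1 := hM O hO' J'
  change M.OutputsWithin O (J'.encode (Equiv.refl _)) (Nat.bits ((J'.Homs H').ncard % p))
    (time.eval (J'.encode (Equiv.refl _)).length) at h1
  rw [hcode, hcount] at h1
  exact h1
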